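/- Let $\mathcal A=(L_1,\dots,L_9)$ be an arrangement of nine distinct lines in $\mathbb{CP}^2$. The multiplicity of a point is the number of lines of $\mathcal A$ through it; a multiple point is a point of multiplicity at least $3$, and a triple point is a point of multiplicity exactly $3$. Assume that $\mathcal A$ has exactly nine triple points, that every multiple point of $\mathcal A$ is a triple point, and that each line $L_i$ passes through exactly three triple points. Let $L(\mathcal B)$ denote the intersection lattice of an ordered tuple $\mathcal B=(L_1',\dots,L_9')$ of lines, that is, the set of all intersections of lines of $\mathcal B$ ordered by reverse inclusion, and write $L(\mathcal B)\sim L(\mathcal A)$ if there is an isomorphism of lattices $L(\mathcal B)\to L(\mathcal A)$ sending $L_i'$ to $L_i$ for every $i$. Then the moduli space $$\mathcal M_{\mathcal A}=\{\mathcal B\in((\mathbb{CP}^2)^*)^9 \mid L(\mathcal B)\sim L(\mathcal A)\}\big/\mathrm{PGL}_3(\mathbb C),$$ with the quotient of the Zariski topology, is irreducible. -/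

import Mathlib

open scoped LinearAlgebra.Projectivization MatrixGroups

namespace LineArrangement

/-- The complex projective plane. -/
abbrev P2 : Type := ℙ ℂ (Fin 3 → ℂ)

/-- The dual projective plane: the point `[a : b : c]` stands for the line
`a x + b y + c z = 0` of the projective plane. -/
abbrev DualP2 : Type := ℙ ℂ (Fin 3 → ℂ)

/-- The set of points of the line with the given coefficients. -/
def line (L : DualP2) : Set P2 := {P | L.orthogonal P}

/-- The multiplicity of a point: the number of indices `i` whose line passes through it. -/
noncomputable def multiplicity {n : ℕ} (A : Fin n → DualP2) (P : P2) : ℕ :=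
  {i | P ∈ line (A i)}.ncard

/-- A multiple point is a point of multiplicity at least three. -/
def IsMultiplePoint {n : ℕ} (A : Fin n → DualP2) (P : P2) : Prop :=
  3 ≤ multiplicity A P

/-- A triple point is a point of multiplicity exactly three. -/
def IsTriplePoint {n : ℕ} (A : Fin n → DualP2) (P : P2) : Prop :=
  multiplicity A P = 3

/-! ### The intersection lattice -/

/-- All intersections of subfamilies of the lines of `A`, among them the whole plane
(the intersection of the empty subfamily). -/
def flats {n : ℕ} (A : Fin n → DualP2) : Set (Set P2) :=
  {X | ∃ S : Set (Fin n), X = ⋂ i ∈ S, line (A i)}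

/-- The intersection lattice `L(A)`: the intersections of lines of `A`, ordered by reverse
inclusion. -/
abbrev IntersectionLattice {n : ℕ} (A : Fin n → DualP2) : Type := (flats A)ᵒᵈ

/-- The `i`-th line, as an element (an atom) of the intersection lattice. -/
def IntersectionLattice.atom {n : ℕ} (A : Fin n → DualP2) (i : Fin n) :
    IntersectionLattice A :=
  OrderDual.toDual ⟨line (A i), {i}, by simp⟩

/-- `L(B) ∼ L(A)` for ordered arrangements: there is an isomorphism of the intersection lattices
carrying the `i`-th line of `B` to the `i`-th line of `A`. -/
def LatticeEquivalent {n : ℕ} (B A : Fin n → DualP2) : Prop :=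
  ∃ e : IntersectionLattice B ≃o IntersectionLattice A,
    ∀ i, e (IntersectionLattice.atom B i) = IntersectionLattice.atom A i

/-! ### The Zariski topology on the product of `n` dual planes -/

/-- The multidegree of the variable `(i, j)`, the `j`-th homogeneous coordinate on the `i`-th
factor, is the `i`-th unit vector. -/
def multidegree {n : ℕ} (p : Fin n × Fin 3) : Fin n → ℕ := Pi.single p.1 1

/-- Polynomials that are homogeneous in the coordinates of each factor separately. -/
def IsMultihomogeneous {n : ℕ} (f : MvPolynomial (Fin n × Fin 3) ℂ) : Prop :=
  ∃ d : Fin n → ℕ, MvPolynomial.IsWeightedHomogeneous multidegree f d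

/-- The vanishing of `f` at the chosen homogeneous coordinates of the entries of `B`. -/
def Vanishes {n : ℕ} (f : MvPolynomial (Fin n × Fin 3) ℂ) (B : Fin n → DualP2) : Prop :=
  MvPolynomial.eval (fun p => (B p.1).rep p.2) f = 0

/-- For a multihomogeneous polynomial, vanishing does not depend on the choice of homogeneous
coordinates. -/
theorem vanishes_iff {n : ℕ} {f : MvPolynomial (Fin n × Fin 3) ℂ} (hf : IsMultihomogeneous f)
    (B : Fin n → DualP2) (v : Fin n → Fin 3 → ℂ) (hv : ∀ i, v i ≠ 0)
    (hB : ∀ i, Projectivization.mk ℂ (v i) (hv i) = B i) :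
    Vanishes f B ↔ MvPolynomial.eval (fun p => v p.1 p.2) f = 0 := by
  obtain ⟨d, hd⟩ := hf
  have h1 : ∀ i, ∃ a : ℂˣ, a • v i = (B i).rep := fun i => by
    rw [← hB i]; exact Projectivization.exists_smul_eq_mk_rep ℂ (v i) (hv i)
  choose a ha using h1
  have key : MvPolynomial.eval (fun p => (B p.1).rep p.2) f
      = (∏ i, (a i : ℂ) ^ d i) * MvPolynomial.eval (fun p => v p.1 p.2) f := by
    rw [MvPolynomial.eval_eq, MvPolynomial.eval_eq, Finset.mul_sum]
    refine Finset.sum_congr rfl fun m hm => ?_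
    have hw := hd (MvPolynomial.mem_support_iff.mp hm)
    have hdeg : ∀ i, d i = ∑ j, m (i, j) := fun i => by
      rw [← hw, Finsupp.weight_apply, Finsupp.sum_fintype _ _ (by simp), Finset.sum_apply,
        Fintype.sum_prod_type, Finset.sum_eq_single i]
      · simp [multidegree]
      · intro k _ hk
        simp [multidegree, hk.symm]
      · simp
    have h2 : ∏ p ∈ m.support, (B p.1).rep p.2 ^ m p
        = (∏ i, (a i : ℂ) ^ d i) * ∏ p ∈ m.support, v p.1 p.2 ^ m p := by
      have e1 : ∀ w : Fin n × Fin 3 → ℂ, ∏ p ∈ m.support, w p ^ m p = ∏ p, w p ^ m p := fun w =>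
        Finset.prod_subset (Finset.subset_univ _) (by
          intro p _ hp
          simp [Finsupp.notMem_support_iff.mp hp])
      rw [e1, e1, Fintype.prod_prod_type, Fintype.prod_prod_type, ← Finset.prod_mul_distrib]
      refine Finset.prod_congr rfl fun i _ => ?_
      rw [hdeg i, ← Finset.prod_pow_eq_pow_sum, ← Finset.prod_mul_distrib]
      refine Finset.prod_congr rfl fun j _ => ?_
      rw [← ha i, Pi.smul_apply, Units.smul_def, smul_eq_mul, mul_pow]
    rw [h2]; ring
  have hne : (∏ i, (a i : ℂ) ^ d i) ≠ 0 :=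
    Finset.prod_ne_zero_iff.mpr fun i _ => pow_ne_zero _ (a i).ne_zero
  rw [Vanishes, key, mul_eq_zero, or_iff_right hne]

/-- The common zero locus of a set of polynomials. -/
def zeroLocus {n : ℕ} (S : Set (MvPolynomial (Fin n × Fin 3) ℂ)) : Set (Fin n → DualP2) :=
  {B | ∀ f ∈ S, Vanishes f B}

/-- The Zariski topology on the product of `n` copies of the dual plane: the closed sets are the
common zero loci of sets of multihomogeneous polynomials. -/
@[reducible] def zariskiTopology (n : ℕ) : TopologicalSpace (Fin n → DualP2) :=
  TopologicalSpace.ofClosed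
    {Z | ∃ S : Set (MvPolynomial (Fin n × Fin 3) ℂ),
      (∀ f ∈ S, IsMultihomogeneous f) ∧ Z = zeroLocus S}
    (by
      refine ⟨{1}, ?_, ?_⟩
      · rintro f rfl
        exact ⟨0, MvPolynomial.isWeightedHomogeneous_one ℂ _⟩
      · ext B
        simp [zeroLocus, Vanishes])
    (by
      intro T hT
      refine ⟨{f | IsMultihomogeneous f ∧ ∃ Z ∈ T, ∀ B ∈ Z, Vanishes f B}, fun f hf => hf.1, ?_⟩
      ext B
      constructor
      · rintro hB f ⟨_, Z, hZ, hfZ⟩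
        exact hfZ B (hB Z hZ)
      · intro hB Z hZ
        obtain ⟨S, hS, rfl⟩ := hT hZ
        exact fun f hf => hB f ⟨hS f hf, _, hZ, fun C hC => hC f hf⟩)
    (by
      rintro _ ⟨S, hS, rfl⟩ _ ⟨T, hT, rfl⟩
      refine ⟨{h | ∃ f ∈ S, ∃ g ∈ T, h = f * g}, ?_, ?_⟩
      · rintro _ ⟨f, hf, g, hg, rfl⟩
        obtain ⟨d, hd⟩ := hS f hf
        obtain ⟨d', hd'⟩ := hT g hg
        exact ⟨d + d', hd.mul hd'⟩
      · ext B
        constructor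
        · rintro (hB | hB) _ ⟨f, hf, g, hg, rfl⟩
          · have : MvPolynomial.eval _ f = 0 := hB f hf
            simp [Vanishes, this]
          · have : MvPolynomial.eval _ g = 0 := hB g hg
            simp [Vanishes, this]
        · intro hB
          by_contra hcon
          simp only [Set.mem_union, not_or, zeroLocus, Set.mem_ofPred_eq, not_forall] at hcon
          obtain ⟨⟨f, hf, hfB⟩, g, hg, hgB⟩ := hcon
          have : MvPolynomial.eval _ (f * g) = 0 := hB _ ⟨f, hf, g, hg, rfl⟩
          rw [map_mul] at this
          exact (mul_eq_zero.mp this).elim hfB hgB)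

/-! ### The moduli space -/

/-- The ordered `n`-tuples of lines with the same labelled intersection lattice as `A`. -/
abbrev RealizationSpace {n : ℕ} (A : Fin n → DualP2) : Type :=
  {B : Fin n → DualP2 // LatticeEquivalent B A}

/-- The subspace topology of the Zariski topology. -/
instance {n : ℕ} (A : Fin n → DualP2) : TopologicalSpace (RealizationSpace A) :=
  TopologicalSpace.induced Subtype.val (zariskiTopology n)

/-- Two ordered arrangements are projectively equivalent if one projective transformation in
`PGL₃(ℂ)` carries the `i`-th line of the first to the `i`-th line of the second for all `i`. -/
def projectiveSetoid {n : ℕ} (A : Fin n → DualP2) : Setoid (RealizationSpace A) where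
  r B C := ∃ g : PGL(Fin 3, ℂ), ∀ i, (fun P : P2 => g • P) '' line (B.1 i) = line (C.1 i)
  iseqv :=
    { refl := fun B => ⟨1, fun i => by simp⟩
      symm := by
        rintro B C ⟨g, hg⟩
        refine ⟨g⁻¹, fun i => ?_⟩
        rw [← hg i, Set.image_image]
        simp
      trans := by
        rintro B C D ⟨g, hg⟩ ⟨h, hh⟩
        refine ⟨h * g, fun i => ?_⟩
        rw [← hh i, ← hg i, Set.image_image]
        simp [mul_smul] }

/-- The moduli space `M_A`: the realization space modulo `PGL₃(ℂ)`, with the quotient topology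
of the Zariski topology. -/
abbrev ModuliSpace {n : ℕ} (A : Fin n → DualP2) : Type := Quotient (projectiveSetoid A)

end LineArrangement

/-!
The moduli space is irreducible because, up to projective equivalence, all realizations of the
arrangement are the values of one polynomial map on an affine space.

Lines are treated as vectors of coefficients in `ℂ³`. For an arrangement without a point common to
all lines, having the same labelled intersection lattice means having the same vanishing `3 × 3`
determinants (`latticeEquivalent_of_sameDependencies`, `sameDependencies_of_latticeEquivalent`).
Suppose that a tuple `v` of vectors of polynomials satisfies all dependencies of the arrangement and
that every realization is projectively equivalent to a value of `v`. The parameters whose values are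
realizations form the complement of a hypersurface, and every nonempty open subset of the moduli
space contains all of them outside a further hypersurface. As a product of nonzero polynomials does
not vanish identically, two nonempty open sets meet: `irreducibleSpace_of_parametrization`.

The triple points, regarded as blocks of three lines, form a combinatorial configuration `(9₃)`.
There are three of them up to relabelling (`IsNineThree.exists_perm`): the Pappus configuration, and
those whose graph of pairs without a common block is a hexagon together with a triangle, or a
nonagon. The classification is a small backtracking search, whose correctness is proved in
`search_sound` and whose result is computed by the kernel.

In each of the three configurations the elements `0`, `1`, `2` form a triangle with the elements
`3`, `4`, `5` on its sides. A projective transformation puts `0`, `1`, `2`, `3`, `4` in standard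
position (`exists_frame`), and the remaining dependencies become polynomial equations in seven
coordinates (`frameVectors`). The solutions form an open part of an affine plane for the Pappus
configuration, of an affine line for the hexagon configuration, and of a smooth conic through a
known point, hence a rational curve, for the cyclic one.
-/

open scoped LinearAlgebra.Projectivization MatrixGroups

namespace LineArrangement

open Matrix

/-! ### Points and lines of the projective plane -/

/-- The determinant of the `3 × 3` matrix with rows `u`, `v`, `w`. -/
def tripleDet {R : Type*} [CommRing R] (u v w : Fin 3 → R) : R :=
  Matrix.det (Matrix.of ![u, v, w])

theorem tripleDet_expand {R : Type*} [CommRing R] (u v w : Fin 3 → R) :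
    tripleDet u v w = u 0 * v 1 * w 2 - u 0 * v 2 * w 1 - u 1 * v 0 * w 2 + u 1 * v 2 * w 0
      + u 2 * v 0 * w 1 - u 2 * v 1 * w 0 := by
  simp [tripleDet, Matrix.det_fin_three]

theorem tripleDet_smul {R : Type*} [CommRing R] (a b c : R) (u v w : Fin 3 → R) :
    tripleDet (a • u) (b • v) (c • w) = a * b * c * tripleDet u v w := by
  simp only [tripleDet_expand, Pi.smul_apply, smul_eq_mul]; ring

theorem map_tripleDet {R S : Type*} [CommRing R] [CommRing S] (f : R →+* S)
    (u v w : Fin 3 → R) :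
    tripleDet (fun j => f (u j)) (fun j => f (v j)) (fun j => f (w j))
      = f (tripleDet u v w) := by
  simp [tripleDet_expand]

theorem tripleDet_mulVec {R : Type*} [CommRing R] (N : Matrix (Fin 3) (Fin 3) R)
    (u v w : Fin 3 → R) :
    tripleDet (N *ᵥ u) (N *ᵥ v) (N *ᵥ w) = N.det * tripleDet u v w := by
  simp only [tripleDet_expand, Matrix.det_fin_three, Matrix.mulVec, dotProduct, Fin.sum_univ_three]
  ring

/-- The determinant of the coefficient vectors of three lines. Only its vanishing is independent
of the chosen coefficient vectors. -/
noncomputable def lineDet (L M K : DualP2) : ℂ := tripleDet L.rep M.rep K.rep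

theorem lineDet_mk {u v w : Fin 3 → ℂ} (hu : u ≠ 0) (hv : v ≠ 0) (hw : w ≠ 0) :
    lineDet (.mk ℂ u hu) (.mk ℂ v hv) (.mk ℂ w hw) = 0 ↔ tripleDet u v w = 0 := by
  obtain ⟨a, ha⟩ := Projectivization.exists_smul_eq_mk_rep ℂ u hu
  obtain ⟨b, hb⟩ := Projectivization.exists_smul_eq_mk_rep ℂ v hv
  obtain ⟨c, hc⟩ := Projectivization.exists_smul_eq_mk_rep ℂ w hw
  rw [lineDet, ← ha, ← hb, ← hc, Units.smul_def, Units.smul_def, Units.smul_def, tripleDet_smul]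
  simp

theorem mem_line_mk {L : DualP2} {v : Fin 3 → ℂ} (hv : v ≠ 0) :
    Projectivization.mk ℂ v hv ∈ line L ↔ L.rep ⬝ᵥ v = 0 := by
  conv_lhs => rw [← L.mk_rep]
  exact Projectivization.orthogonal_mk L.rep_nonzero hv

theorem mem_line_iff {L : DualP2} {P : P2} : P ∈ line L ↔ L.rep ⬝ᵥ P.rep = 0 := by
  conv_lhs => rw [← P.mk_rep]
  exact mem_line_mk P.rep_nonzero

open Classical in
theorem cross_mem_left {L M : DualP2} (h : L ≠ M) : Projectivization.cross L M ∈ line L :=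
  Projectivization.orthogonal_cross_left h

open Classical in
theorem cross_mem_right {L M : DualP2} (h : L ≠ M) : Projectivization.cross L M ∈ line M :=
  Projectivization.orthogonal_cross_right h

open Classical in
theorem eq_cross {L M : DualP2} {P : P2} (h : L ≠ M) (hL : P ∈ line L) (hM : P ∈ line M) :
    P = Projectivization.cross L M := by
  rw [mem_line_iff] at hL hM
  have hLM : Projectivization.mk ℂ L.rep L.rep_nonzero ≠ .mk ℂ M.rep M.rep_nonzero := by
    simpa using h
  have h2 := Projectivization.cross_mk_of_ne L.rep_nonzero M.rep_nonzero hLM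
  simp only [Projectivization.mk_rep] at h2
  rw [h2, ← P.mk_rep, Projectivization.mk_eq_mk_iff_crossProduct_eq_zero]
  rw [dotProduct, Fin.sum_univ_three] at hL hM
  ext i
  fin_cases i
  · simp [cross_apply]
    linear_combination (L.rep 0) * hM - (M.rep 0) * hL
  · simp [cross_apply]
    linear_combination (L.rep 1) * hM - (M.rep 1) * hL
  · simp [cross_apply]
    linear_combination (L.rep 2) * hM - (M.rep 2) * hL

open Classical in
theorem lineDet_eq_zero_iff {L M K : DualP2} (h : L ≠ M) :
    lineDet L M K = 0 ↔ Projectivization.cross L M ∈ line K := by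
  have hLM : Projectivization.mk ℂ L.rep L.rep_nonzero ≠ .mk ℂ M.rep M.rep_nonzero := by
    simpa using h
  have h2 := Projectivization.cross_mk_of_ne L.rep_nonzero M.rep_nonzero hLM
  simp only [Projectivization.mk_rep] at h2
  rw [h2, mem_line_mk, lineDet, tripleDet_expand, dotProduct, Fin.sum_univ_three]
  simp only [cross_apply, Matrix.cons_val]
  constructor <;> intro h <;> linear_combination h

theorem line_subset_line {L M : DualP2} (h : line L ⊆ line M) : L = M := by
  classical
  by_contra hne
  obtain ⟨K, hK⟩ := Projectivization.exists_not_orthogonal_self (Projectivization.cross L M)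
  have hLK : L ≠ K := by
    rintro rfl
    exact hK (cross_mem_left hne)
  have h2 := eq_cross hne (cross_mem_left hLK) (h (cross_mem_left hLK))
  exact hK (h2 ▸ cross_mem_right hLK)

theorem line_injective : Function.Injective line := fun _ _ h => line_subset_line h.subset

/-! ### The intersection lattice and vanishing determinants -/

/-- Any two lines of the arrangement are completed by a third one to a triple with nonzero
determinant. For at least two lines this says that they are distinct and have no common point. -/
def IsEssential {n : ℕ} (A : Fin n → DualP2) : Prop :=
  ∀ i j, i ≠ j → ∃ k, lineDet (A i) (A j) (A k) ≠ 0

/-- Two arrangements have the same dependent triples of lines. Repeated indices are included, but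
impose no condition. -/
def SameDependencies {n : ℕ} (B A : Fin n → DualP2) : Prop :=
  ∀ i j k, lineDet (B i) (B j) (B k) = 0 ↔ lineDet (A i) (A j) (A k) = 0

theorem lineDet_self (L K : DualP2) : lineDet L L K = 0 := by
  rw [lineDet, tripleDet_expand]; ring

theorem IsEssential.injective {n : ℕ} {A : Fin n → DualP2} (hA : IsEssential A) :
    Function.Injective A := by
  intro i j hij
  by_contra hne
  obtain ⟨k, hk⟩ := hA i j hne
  exact hk (by rw [hij, lineDet_self])

theorem lineDet_eq_zero_iff_subset {L M K : DualP2} (h : L ≠ M) :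
    lineDet L M K = 0 ↔ line L ∩ line M ⊆ line K := by
  classical
  rw [lineDet_eq_zero_iff h]
  constructor
  · rintro hK P ⟨hL, hM⟩
    rwa [eq_cross h hL hM]
  · intro hs
    exact hs ⟨cross_mem_left h, cross_mem_right h⟩

/-- The inclusion of a flat in a line, expressed through dependent triples. The point where the
`i`-th and the `j`-th line meet either lies on the `k`-th line or is cut out of the flat by some
`l`-th line. -/
theorem iInter_subset_line_iff {n : ℕ} {A : Fin n → DualP2} (hA : Function.Injective A)
    (S : Set (Fin n)) {i j : Fin n} (hi : i ∈ S) (hj : j ∈ S) (hij : i ≠ j) (k : Fin n) :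
    (⋂ l ∈ S, line (A l)) ⊆ line (A k) ↔
      lineDet (A i) (A j) (A k) = 0 ∨ ∃ l ∈ S, lineDet (A i) (A j) (A l) ≠ 0 := by
  classical
  have hne := hA.ne hij
  simp only [ne_eq, lineDet_eq_zero_iff hne]
  constructor
  · intro h
    by_contra! hcon
    exact hcon.1 (h (by simpa using hcon.2))
  · rintro h P hP
    simp only [Set.mem_iInter] at hP
    have hPe := eq_cross hne (hP i hi) (hP j hj)
    rcases h with h | ⟨l, hl, h⟩
    · rwa [hPe]
    · exact absurd (hPe ▸ hP l hl) h

theorem iInter_subset_line_congr {n : ℕ} {A B : Fin n → DualP2} (hA : Function.Injective A)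
    (hB : Function.Injective B) (h : SameDependencies B A) (S : Set (Fin n)) (k : Fin n) :
    (⋂ l ∈ S, line (B l)) ⊆ line (B k) ↔ (⋂ l ∈ S, line (A l)) ⊆ line (A k) := by
  by_cases hS : S.Subsingleton
  · rcases hS.eq_empty_or_singleton with rfl | ⟨i, rfl⟩
    · simp only [Set.mem_empty_iff_false, Set.iInter_of_empty, Set.iInter_univ,
        Set.univ_subset_iff]
      have key : ∀ L : DualP2, line L ≠ Set.univ := fun L hL => by
        obtain ⟨w, hw⟩ := Projectivization.exists_not_self_orthogonal L
        exact hw (hL ▸ Set.mem_univ w : w ∈ line L)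
      simp [key]
    · simp only [Set.mem_singleton_iff, Set.iInter_iInter_eq_left]
      have key : ∀ C : Fin n → DualP2, Function.Injective C →
          (line (C i) ⊆ line (C k) ↔ i = k) := fun C hC =>
        ⟨fun hs => hC (line_subset_line hs), fun hs => hs ▸ subset_rfl⟩
      rw [key A hA, key B hB]
  · rw [Set.not_subsingleton_iff] at hS
    obtain ⟨i, hi, j, hj, hij⟩ := hS
    rw [iInter_subset_line_iff hA S hi hj hij, iInter_subset_line_iff hB S hi hj hij]
    simp only [ne_eq, h i j]

theorem iInter_subset_iInter_congr {n : ℕ} {A B : Fin n → DualP2} (hA : Function.Injective A)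
    (hB : Function.Injective B) (h : SameDependencies B A) (S T : Set (Fin n)) :
    (⋂ l ∈ S, line (B l)) ⊆ (⋂ l ∈ T, line (B l)) ↔
      (⋂ l ∈ S, line (A l)) ⊆ (⋂ l ∈ T, line (A l)) := by
  simp only [Set.subset_iInter_iff, iInter_subset_line_congr hA hB h]

/-- The inclusions between flats are determined by the dependent triples, so sending the intersection
of a subfamily of lines of `B` to that of the corresponding lines of `A` is well defined. -/
theorem latticeEquivalent_of_sameDependencies {n : ℕ} {A B : Fin n → DualP2}
    (hA : IsEssential A) (h : SameDependencies B A) : LatticeEquivalent B A := by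
  have hB : IsEssential B := fun i j hij => by
    obtain ⟨k, hk⟩ := hA i j hij
    exact ⟨k, fun h0 => hk ((h i j k).1 h0)⟩
  have key := iInter_subset_iInter_congr hA.injective hB.injective h
  have keyeq : ∀ S T : Set (Fin n), (⋂ l ∈ S, line (B l)) = (⋂ l ∈ T, line (B l)) ↔
      (⋂ l ∈ S, line (A l)) = (⋂ l ∈ T, line (A l)) := fun S T => by
    simp only [Set.Subset.antisymm_iff, key]
  choose! s hs using fun (X : Set P2) (hX : X ∈ flats B) => hX
  choose! t ht using fun (X : Set P2) (hX : X ∈ flats A) => hX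
  let e : flats B ≃o flats A :=
    { toFun := fun X => ⟨⋂ i ∈ s X.1, line (A i), s X.1, rfl⟩
      invFun := fun X => ⟨⋂ i ∈ t X.1, line (B i), t X.1, rfl⟩
      left_inv := fun X => Subtype.ext <| by
        dsimp only
        rw [eq_comm]
        conv_lhs => rw [hs X.1 X.2]
        rw [keyeq]
        exact ht _ ⟨_, rfl⟩
      right_inv := fun X => Subtype.ext <| by
        dsimp only
        rw [eq_comm]
        conv_lhs => rw [ht X.1 X.2]
        rw [← keyeq]
        exact hs _ ⟨_, rfl⟩
      map_rel_iff' := fun {X Y} => by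
        change (⋂ i ∈ s X.1, line (A i)) ⊆ (⋂ i ∈ s Y.1, line (A i)) ↔ X.1 ⊆ Y.1
        rw [← key, ← hs X.1 X.2, ← hs Y.1 Y.2] }
  refine ⟨e.dual, fun i => ?_⟩
  refine congrArg OrderDual.toDual (Subtype.ext ?_)
  change ⋂ j ∈ s (line (B i)), line (A j) = line (A i)
  have h1 := hs (line (B i)) ⟨{i}, by simp⟩
  have h2 := (keyeq {i} (s (line (B i)))).1 (by simpa using h1)
  simpa using h2.symm

/-- Conversely, whether the `k`-th line contains the intersection of the `i`-th and the `j`-th can be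
read off from the lattice. -/
theorem sameDependencies_of_latticeEquivalent {n : ℕ} {A B : Fin n → DualP2}
    (hA : Function.Injective A) (h : LatticeEquivalent B A) : SameDependencies B A := by
  obtain ⟨e, he⟩ := h
  have hB : Function.Injective B := by
    intro i j hij
    have h1 : IntersectionLattice.atom B i = IntersectionLattice.atom B j := by
      simp [IntersectionLattice.atom, hij]
    have h2 : IntersectionLattice.atom A i = IntersectionLattice.atom A j := by
      rw [← he, ← he, h1]
    exact hA (line_injective (congrArg (fun x => (OrderDual.ofDual x).1) h2))
  -- the inclusion of the intersection of two lines in a third one in terms of the lattice order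
  have key : ∀ (C : Fin n → DualP2) (i j k : Fin n), line (C i) ∩ line (C j) ⊆ line (C k) ↔
      ∀ F : IntersectionLattice C, IntersectionLattice.atom C i ≤ F →
        IntersectionLattice.atom C j ≤ F → IntersectionLattice.atom C k ≤ F := by
    intro C i j k
    constructor
    · intro hs F hi hj
      exact fun P hP => hs ⟨hi hP, hj hP⟩
    · intro hs
      refine hs (OrderDual.toDual ⟨line (C i) ∩ line (C j), {i, j}, ?_⟩) ?_ ?_
      · simp
      · exact Set.inter_subset_left
      · exact Set.inter_subset_right
  intro i j k
  by_cases hij : i = j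
  · simp [hij, lineDet_self]
  rw [lineDet_eq_zero_iff_subset (hA.ne hij), lineDet_eq_zero_iff_subset (hB.ne hij), key, key]
  constructor
  · intro hs F
    obtain ⟨F, rfl⟩ := e.surjective F
    simpa only [← he, e.le_iff_le] using hs F
  · intro hs F
    have := hs (e F)
    simpa only [← he, e.le_iff_le] using this

/-! ### Projective equivalence -/

open Pointwise in
/-- A linear transformation of the coefficient vectors that carries one arrangement to another makes
the two projectively equivalent. -/
theorem projectiveSetoid_of_mulVec {n : ℕ} {A : Fin n → DualP2} (B C : RealizationSpace A)
    (N : GL (Fin 3) ℂ)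
    (h : ∀ i, ∃ c : ℂ, c ≠ 0 ∧ N.1 *ᵥ (B.1 i).rep = c • (C.1 i).rep) :
    projectiveSetoid A B C := by
  -- lines are transformed by the inverse transpose of the matrix acting on points
  let T : GL (Fin 3) ℂ := ⟨N.1ᵀ, (N⁻¹).1ᵀ,
    by rw [← Matrix.transpose_mul, ← Units.val_mul, inv_mul_cancel]; simp,
    by rw [← Matrix.transpose_mul, ← Units.val_mul, mul_inv_cancel]; simp⟩
  refine ⟨(Matrix.ProjGenLinGroup.mk T)⁻¹, fun i => ?_⟩
  obtain ⟨c, hc, hN⟩ := h i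
  ext Q
  change Q ∈ (Matrix.ProjGenLinGroup.mk T)⁻¹ • line (B.1 i) ↔ _
  rw [Set.mem_smul_set_iff_inv_smul_mem, inv_inv]
  induction Q using Projectivization.ind with | h v hv =>
  rw [Projectivization.PGL.mk_smul_mk, mem_line_mk, mem_line_mk]
  have : T • v = N.1ᵀ *ᵥ v := rfl
  rw [this, Matrix.dotProduct_mulVec, Matrix.vecMul_transpose, hN, smul_dotProduct, smul_eq_mul,
    mul_eq_zero, or_iff_right hc]

/-! ### Irreducibility from a polynomial parametrization -/

/-- A nonempty open set of the moduli space contains every parameter outside the zero locus of some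
nonzero polynomial. -/
theorem exists_polynomial_of_isOpen {σ : Type*} {n : ℕ} {A : Fin n → DualP2}
    (v : Fin n → Fin 3 → MvPolynomial σ ℂ)
    (hpar : ∀ B : RealizationSpace A, ∃ C : RealizationSpace A, projectiveSetoid A B C ∧
      ∃ (t : σ → ℂ) (h : ∀ i, (fun j => MvPolynomial.eval t (v i j)) ≠ 0),
        ∀ i, Projectivization.mk ℂ _ (h i) = C.1 i)
    {U : Set (ModuliSpace A)} (hU : IsOpen U) (hne : U.Nonempty) :
    ∃ F : MvPolynomial σ ℂ, F ≠ 0 ∧ ∀ (C : RealizationSpace A) (t : σ → ℂ)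
      (h : ∀ i, (fun j => MvPolynomial.eval t (v i j)) ≠ 0),
        (∀ i, Projectivization.mk ℂ _ (h i) = C.1 i) → MvPolynomial.eval t F ≠ 0 →
          (Quotient.mk _ C : ModuliSpace A) ∈ U := by
  have hO : IsOpen ((fun C => (Quotient.mk _ C : ModuliSpace A)) ⁻¹' U) :=
    hU.preimage continuous_quotient_mk'
  obtain ⟨O, hO, hOU⟩ := hO
  obtain ⟨S, hS, hOS⟩ : ∃ S : Set (MvPolynomial (Fin n × Fin 3) ℂ),
      (∀ f ∈ S, IsMultihomogeneous f) ∧ Oᶜ = zeroLocus S := hO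
  have mem : ∀ C : RealizationSpace A,
      (Quotient.mk _ C : ModuliSpace A) ∈ U ↔ C.1 ∉ zeroLocus S := fun C => by
    rw [← hOS, Set.notMem_compl_iff]
    exact (Set.ext_iff.1 hOU C).symm
  -- substituting the parametrization in an equation of the complement of `U`
  let sub (f : MvPolynomial (Fin n × Fin 3) ℂ) : MvPolynomial σ ℂ :=
    MvPolynomial.aeval (fun p => v p.1 p.2) f
  have eval_sub : ∀ (t : σ → ℂ) (f), MvPolynomial.eval t (sub f)
      = MvPolynomial.eval (fun p => MvPolynomial.eval t (v p.1 p.2)) f := fun t f => by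
    simp only [sub, MvPolynomial.map_aeval]
    have : (MvPolynomial.eval t).comp (algebraMap ℂ (MvPolynomial σ ℂ)) = RingHom.id ℂ := by
      ext z; simp [MvPolynomial.algebraMap_eq]
    rw [this]
    rfl
  obtain ⟨q, hq⟩ := hne
  obtain ⟨B, rfl⟩ := Quotient.exists_rep q
  obtain ⟨C, hBC, t, h, htC⟩ := hpar B
  have hCU : (Quotient.mk _ C : ModuliSpace A) ∈ U := by
    rwa [← Quotient.sound hBC]
  rw [mem] at hCU
  obtain ⟨f, hfS, hf⟩ : ∃ f ∈ S, ¬ Vanishes f C.1 := by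
    simpa [zeroLocus] using hCU
  rw [vanishes_iff (hS f hfS) _ _ h htC, ← eval_sub] at hf
  refine ⟨sub f, fun h0 => hf (by simp [h0]), fun C' t' h' ht' hF => ?_⟩
  rw [mem]
  intro hz
  rw [eval_sub] at hF
  exact hF ((vanishes_iff (hS f hfS) _ _ h' ht').1 (hz f hfS))

/-- The moduli space of an essential arrangement is irreducible as soon as all realizations are, up
to projective equivalence, among the values of a polynomial map on an affine space whose image
satisfies the dependencies of the arrangement. The parameters of realizations are then the
complement of a hypersurface of the affine space. -/
theorem irreducibleSpace_of_parametrization {σ : Type*} {n : ℕ} {A : Fin n → DualP2}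
    (hn : 2 ≤ n) (hA : IsEssential A) (v : Fin n → Fin 3 → MvPolynomial σ ℂ)
    (hdep : ∀ i j k, lineDet (A i) (A j) (A k) = 0 → tripleDet (v i) (v j) (v k) = 0)
    (hpar : ∀ B, SameDependencies B A → ∃ (t : σ → ℂ) (N : GL (Fin 3) ℂ), ∀ i, ∃ c : ℂ,
      c ≠ 0 ∧ N.1 *ᵥ (B i).rep = c • fun j => MvPolynomial.eval t (v i j)) :
    IrreducibleSpace (ModuliSpace A) := by
  classical
  have hrefl : SameDependencies A A := fun i j k => Iff.rfl
  have hpar' : ∀ B : RealizationSpace A, ∃ C : RealizationSpace A, projectiveSetoid A B C ∧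
      ∃ (t : σ → ℂ) (h : ∀ i, (fun j => MvPolynomial.eval t (v i j)) ≠ 0),
        (∀ i, Projectivization.mk ℂ _ (h i) = C.1 i) := by
    intro B
    have hB := sameDependencies_of_latticeEquivalent hA.injective B.2
    obtain ⟨t, N, hN⟩ := hpar B.1 hB
    have h : ∀ i, (fun j => MvPolynomial.eval t (v i j)) ≠ 0 := by
      intro i h0
      obtain ⟨c, hc, hi⟩ := hN i
      rw [h0, smul_zero] at hi
      refine (B.1 i).rep_nonzero ?_
      have := congrArg ((N⁻¹).1 *ᵥ ·) hi
      simpa [Matrix.mulVec_mulVec, ← Units.val_mul] using this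
    let C : Fin n → DualP2 := fun i => .mk ℂ _ (h i)
    have hN' : ∀ i, ∃ c : ℂ, c ≠ 0 ∧ N.1 *ᵥ (B.1 i).rep = c • (C i).rep := by
      intro i
      obtain ⟨c, hc, hi⟩ := hN i
      obtain ⟨a, ha⟩ := Projectivization.exists_smul_eq_mk_rep ℂ _ (h i)
      refine ⟨c * (a⁻¹ : ℂˣ), mul_ne_zero hc (a⁻¹).ne_zero, ?_⟩
      rw [hi, ← ha, Units.smul_def, smul_smul, mul_assoc, ← Units.val_mul, inv_mul_cancel,
        Units.val_one, mul_one]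
    have hC : SameDependencies C A := by
      intro i j k
      rw [← hB i j k]
      choose c hc hcN using hN'
      have hd : N.1.det ≠ 0 := by
        have := (Matrix.isUnit_iff_isUnit_det _).1 N.isUnit
        exact this.ne_zero
      have := tripleDet_mulVec N.1 (B.1 i).rep (B.1 j).rep (B.1 k).rep
      rw [hcN, hcN, hcN, tripleDet_smul] at this
      have hc3 := mul_ne_zero (mul_ne_zero (hc i) (hc j)) (hc k)
      simp only [lineDet]
      constructor
      · intro h0
        rw [h0, mul_zero, eq_comm, mul_eq_zero] at this
        exact this.resolve_left hd
      · intro h0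
        rw [h0, mul_zero, mul_eq_zero] at this
        exact this.resolve_left hc3
    exact ⟨⟨C, latticeEquivalent_of_sameDependencies hA hC⟩,
      projectiveSetoid_of_mulVec _ _ N hN', t, h, fun i => rfl⟩
  -- the product of the determinants that must not vanish
  let D : MvPolynomial σ ℂ := ∏ p ∈ Finset.univ.filter
    (fun p : Fin n × Fin n × Fin n => lineDet (A p.1) (A p.2.1) (A p.2.2) ≠ 0),
      tripleDet (v p.1) (v p.2.1) (v p.2.2)
  have hmap : ∀ (t : σ → ℂ) i j k, MvPolynomial.eval t (tripleDet (v i) (v j) (v k)) =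
      tripleDet (fun m => MvPolynomial.eval t (v i m)) (fun m => MvPolynomial.eval t (v j m))
        (fun m => MvPolynomial.eval t (v k m)) := fun t i j k =>
    (map_tripleDet (MvPolynomial.eval t) _ _ _).symm
  have hD : D ≠ 0 := by
    obtain ⟨C, -, t, h, htC⟩ :=
      hpar' ⟨A, latticeEquivalent_of_sameDependencies hA hrefl⟩
    have hC := sameDependencies_of_latticeEquivalent hA.injective C.2
    refine Finset.prod_ne_zero_iff.2 fun p hp h0 => ?_
    have h1 := hmap t p.1 p.2.1 p.2.2
    rw [h0, map_zero] at h1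
    refine (Finset.mem_filter.1 hp).2 ((hC _ _ _).1 ?_)
    rw [← htC, ← htC, ← htC, lineDet_mk]
    exact h1.symm
  have hreal : ∀ t : σ → ℂ, MvPolynomial.eval t D ≠ 0 → ∃ (C : RealizationSpace A)
      (h : ∀ i, (fun j => MvPolynomial.eval t (v i j)) ≠ 0),
        ∀ i, Projectivization.mk ℂ _ (h i) = C.1 i := by
    intro t ht
    rw [map_prod, Finset.prod_ne_zero_iff] at ht
    have ht' : ∀ i j k, lineDet (A i) (A j) (A k) ≠ 0 →
        tripleDet (fun m => MvPolynomial.eval t (v i m)) (fun m => MvPolynomial.eval t (v j m))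
          (fun m => MvPolynomial.eval t (v k m)) ≠ 0 := fun i j k hijk => by
      rw [← hmap]
      exact ht (i, j, k) (by simpa using hijk)
    have h : ∀ i, (fun j => MvPolynomial.eval t (v i j)) ≠ 0 := by
      intro i h0
      have : Nontrivial (Fin n) := Fin.nontrivial_iff_two_le.2 hn
      obtain ⟨j, hj⟩ := exists_ne i
      obtain ⟨k, hk⟩ := hA i j hj.symm
      refine ht' i j k hk ?_
      rw [h0, tripleDet_expand]
      simp
    refine ⟨⟨fun i => .mk ℂ _ (h i), latticeEquivalent_of_sameDependencies hA ?_⟩, h, fun i => rfl⟩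
    intro i j k
    rw [lineDet_mk]
    refine ⟨fun h0 => by_contra fun h1 => ht' i j k h1 h0, fun h0 => ?_⟩
    rw [← hmap, hdep i j k h0, map_zero]
  have hpre : IsPreirreducible (Set.univ : Set (ModuliSpace A)) := by
    rintro U V hU hV ⟨x, -, hx⟩ ⟨y, -, hy⟩
    obtain ⟨F, hF0, hF⟩ := exists_polynomial_of_isOpen v hpar' hU ⟨x, hx⟩
    obtain ⟨G, hG0, hG⟩ := exists_polynomial_of_isOpen v hpar' hV ⟨y, hy⟩
    obtain ⟨t, ht⟩ : ∃ t, MvPolynomial.eval t (F * G * D) ≠ 0 := by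
      by_contra! hall
      exact mul_ne_zero (mul_ne_zero hF0 hG0) hD
        (MvPolynomial.funext fun t => by rw [hall t, map_zero])
    rw [map_mul, map_mul] at ht
    obtain ⟨C, h, hC⟩ := hreal t (right_ne_zero_of_mul ht)
    exact ⟨Quotient.mk _ C, Set.mem_univ _,
      hF C t h hC (left_ne_zero_of_mul (left_ne_zero_of_mul ht)),
      hG C t h hC (right_ne_zero_of_mul (left_ne_zero_of_mul ht))⟩
  exact
    { isPreirreducible_univ := hpre
      toNonempty := ⟨Quotient.mk _ ⟨A, latticeEquivalent_of_sameDependencies hA hrefl⟩⟩ }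

/-! ### Combinatorial classification of the configurations `(9₃)` -/

/-- A combinatorial configuration `(9₃)`: blocks of three elements on nine elements, three through
each element, any two elements lying in at most one common block. -/
structure IsNineThree (𝓑 : Finset (Finset (Fin 9))) : Prop where
  card_block : ∀ s ∈ 𝓑, s.card = 3
  card_through : ∀ i, (𝓑.filter (i ∈ ·)).card = 3
  eq_of_mem : ∀ s ∈ 𝓑, ∀ t ∈ 𝓑, ∀ i j, i ≠ j → i ∈ s → j ∈ s → i ∈ t → j ∈ t → s = t

/-- The blocks of the Pappus configuration: the graph of pairs of elements without a common block
consists of three triangles. -/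
def pappusBlocks : List (Fin 9 × Fin 9 × Fin 9) :=
  [(2, 6, 7), (3, 5, 6), (3, 4, 7), (4, 5, 8), (0, 7, 8), (1, 6, 8), (0, 1, 3), (1, 2, 4),
    (0, 2, 5)]

/-- The blocks of the configuration for which the graph of pairs of elements without a common block
consists of a hexagon and a triangle. -/
def hexagonBlocks : List (Fin 9 × Fin 9 × Fin 9) :=
  [(2, 6, 7), (3, 5, 7), (3, 4, 6), (4, 5, 8), (0, 7, 8), (1, 6, 8), (0, 1, 3), (1, 2, 4),
    (0, 2, 5)]

/-- The blocks of the configuration for which the graph of pairs of elements without a common block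
is a cycle of length nine. -/
def cyclicBlocks : List (Fin 9 × Fin 9 × Fin 9) :=
  [(3, 4, 7), (4, 6, 8), (5, 6, 7), (0, 7, 8), (1, 5, 8), (2, 3, 6), (0, 1, 3), (1, 2, 4),
    (0, 2, 5)]

/-- The set of elements of a block. -/
def blockSet (b : Fin 9 × Fin 9 × Fin 9) : Finset (Fin 9) := {b.1, b.2.1, b.2.2}

/-- The set of positions of the binary digits `1` of a number: subsets of `Fin 9` are encoded as
numbers below `512` to make the case distinction below a fast kernel computation. -/
def support (m : ℕ) : Finset (Fin 9) := Finset.univ.filter fun i => m.testBit i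

/-- The powers of two that encode the nine elements. -/
def elements : List ℕ := [1, 2, 4, 8, 16, 32, 64, 128, 256]

/-- The number of codes in `l` that contain the element with code `e`. -/
def countThrough (e : ℕ) (l : List ℕ) : ℕ :=
  l.foldr (fun t n => bif Nat.beq (Nat.land t e) 0 then n else Nat.succ n) 0

/-- Whether the sets with codes `s` and `t` have at most one common element: removing the lowest binary
digit `1` of the code of their intersection leaves `0`. -/
def compatible (s t : ℕ) : Bool :=
  Nat.beq (Nat.land (Nat.land s t) (Nat.pred (Nat.land s t))) 0

/-- The code of the element that completes the pair with code `ab` to a block of the list, or `0`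
if there is none. -/
def third (ab : ℕ) : List ℕ → ℕ
  | [] => 0
  | t :: l => bif Nat.beq (Nat.land t ab) ab then Nat.sub t ab else third ab l

/-- Whether the list `s` consists of the codes of all nine elements and replacing `k` by the `k`-th entry
of `s` carries `blocks` into the blocks with codes in `l`. -/
def isLabelling (blocks : List (Fin 9 × Fin 9 × Fin 9)) (l s : List ℕ) : Bool :=
  (blocks.all fun b =>
    l.any (Nat.beq (Nat.add (s.getD b.1 0) (Nat.add (s.getD b.2.1 0) (s.getD b.2.2 0))))) &&
  (Nat.beq s.length 9 && elements.all fun e => s.any (Nat.beq e))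

/-- The value of `f` at `n` if `n` encodes an element. Passing through the list of elements
forces the evaluation of `n`. -/
def withElement (n : ℕ) (f : ℕ → Bool) : Bool :=
  elements.any fun k => Nat.beq n k && f k

/-- A search for a labelling that identifies the blocks with codes in `l` with one of the three
model configurations. The choice of the elements labelled `0`, `1`, `2` forces the others. -/
def labelled (l : List ℕ) : Bool :=
  elements.any fun a => elements.any fun b =>
  withElement (third (Nat.add a b) l) fun d => elements.any fun c =>
  (!Nat.beq c d) && withElement (third (Nat.add b c) l) fun e =>
    withElement (third (Nat.add a c) l) fun f =>
    (withElement (third (Nat.add e f) l) fun i => withElement (third (Nat.add a i) l) fun h =>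
      withElement (third (Nat.add b i) l) fun g =>
        isLabelling pappusBlocks l [a, b, c, d, e, f, g, h, i] ||
        isLabelling hexagonBlocks l [a, b, c, d, e, f, g, h, i]) ||
    (withElement (third (Nat.add b f) l) fun i => withElement (third (Nat.add a i) l) fun h =>
      withElement (third (Nat.add c d) l) fun g =>
        isLabelling cyclicBlocks l [a, b, c, d, e, f, g, h, i])

/-- Whether some element lies on fewer than three of the blocks chosen or still available. -/
def isDeficient (rest chosen : List ℕ) : Bool :=
  elements.any fun e => Nat.blt (Nat.add (countThrough e chosen) (countThrough e rest)) 3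

/-- The backtracking search, which branches on whether the next block of `rest` belongs to the
configuration. The value `true` certifies that every configuration `(9₃)` that contains `chosen` and
is contained in `rest ++ chosen` is one of the models. The first argument bounds the depth. -/
def search : ℕ → List ℕ → List ℕ → Bool
  | 0, _, _ => false
  | n + 1, rest, chosen => isDeficient rest chosen ||
      match rest with
      | [] => (elements.any fun e => Nat.blt 3 (countThrough e chosen)) || labelled chosen
      | c :: rest => search n (rest.filter (compatible c)) (c :: chosen) && search n rest chosen

/-- The codes of the blocks of a configuration whose blocks through `0` are `{0, 1, 2}`, `{0, 3, 4}`
and `{0, 5, 6}`, and which contains the block `{1, 3, 7}`. -/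
def initialBlocks : List ℕ := [7, 25, 97, 138]

/-- The codes of all blocks that the initial blocks can be completed with. Deciding first on the
blocks through `8` and `7`, the largest codes, keeps the search small. -/
def candidateBlocks : List ℕ :=
  (List.range 512).reverse.filter fun t =>
    decide ((support t).card = 3) && Nat.beq (Nat.land t 1) 0 &&
      initialBlocks.all fun s => compatible s t

/-- The bound `40` exceeds the number of candidate blocks, so no branch is cut off by it. -/
theorem search_initialBlocks : search 40 candidateBlocks initialBlocks = true := by
  decide +kernel

theorem mem_support {m : ℕ} {i : Fin 9} : i ∈ support m ↔ m.testBit i = true := by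
  simp [support]

theorem land_two_pow_eq_zero (m i : ℕ) : Nat.land m (2 ^ i) = 0 ↔ m.testBit i = false := by
  change m &&& 2 ^ i = 0 ↔ _
  rw [Nat.and_two_pow]
  cases m.testBit i <;> simp

theorem countThrough_two_pow (i : Fin 9) (l : List ℕ) :
    countThrough (2 ^ i.val) l = (l.filter (fun m => i ∈ support m)).length := by
  induction l with
  | nil => rfl
  | cons m l ih =>
    rw [countThrough, List.foldr_cons, ← countThrough, ih, List.filter_cons]
    have h : (Nat.beq (Nat.land m (2 ^ i.val)) 0) = !m.testBit i := by
      rw [Bool.eq_iff_iff, Nat.beq_eq, land_two_pow_eq_zero]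
      simp
    rw [h]
    cases hb : m.testBit i <;> simp [mem_support, hb]

theorem mem_elements {e : ℕ} : e ∈ elements ↔ ∃ i : Fin 9, e = 2 ^ i.val := by
  have : elements = List.ofFn (fun i : Fin 9 => 2 ^ i.val) := by decide
  rw [this, List.mem_ofFn']
  simp [eq_comm]

theorem support_injOn {m m' : ℕ} (hm : m < 512) (hm' : m' < 512) (h : support m = support m') :
    m = m' := by
  apply Nat.eq_of_testBit_eq
  intro i
  by_cases hi : i < 9
  · have := Finset.ext_iff.1 h ⟨i, hi⟩
    rw [mem_support, mem_support] at this
    exact Bool.eq_iff_iff.2 this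
  · have h9 : 2 ^ 9 ≤ 2 ^ i := Nat.pow_le_pow_right (by norm_num) (by omega)
    rw [Nat.testBit_lt_two_pow (by omega), Nat.testBit_lt_two_pow (by omega)]

theorem exists_support_eq (s : Finset (Fin 9)) : ∃ m < 512, support m = s := by
  have h : Function.Bijective (fun m : Fin 512 => support m.val) := by
    rw [Fintype.bijective_iff_injective_and_card]
    exact ⟨fun m m' h => Fin.ext (support_injOn m.2 m'.2 h), by simp⟩
  obtain ⟨m, hm⟩ := h.2 s
  exact ⟨m.val, m.2, hm⟩

/-- A nonzero number that is not a power of two has two binary digits `1`. -/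
theorem exists_mem_support_of_pred (x : ℕ) (hx : x < 512)
    (h : Nat.beq (Nat.land x x.pred) 0 = false) :
    ∃ i j, i ≠ j ∧ i ∈ support x ∧ j ∈ support x := by
  have key : ∀ x < 512, Nat.beq (Nat.land x x.pred) 0 = false → 1 < (support x).card := by
    decide +kernel
  obtain ⟨i, hi, j, hj, hij⟩ := Finset.one_lt_card.1 (key x hx h)
  exact ⟨i, j, hij, hi, hj⟩

theorem IsNineThree.compatible {𝓑 : Finset (Finset (Fin 9))} (h : IsNineThree 𝓑) {m m' : ℕ}
    (hm : m < 512) (hm' : m' < 512) (hmB : support m ∈ 𝓑) (hmB' : support m' ∈ 𝓑) (hne : m ≠ m') :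
    compatible m m' = true := by
  by_contra hc
  rw [Bool.not_eq_true, LineArrangement.compatible] at hc
  have hx : Nat.land m m' < 512 := lt_of_le_of_lt Nat.and_le_left hm
  obtain ⟨i, j, hij, hi, hj⟩ := exists_mem_support_of_pred _ hx hc
  have key : ∀ k : Fin 9, k ∈ support (Nat.land m m') → k ∈ support m ∧ k ∈ support m' := by
    intro k hk
    rw [mem_support] at hk ⊢
    rw [mem_support]
    have : (m &&& m').testBit k = true := hk
    simpa using this
  exact hne (support_injOn hm hm' (h.eq_of_mem _ hmB _ hmB' i j hij (key i hi).1 (key j hj).1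
    (key i hi).2 (key j hj).2))

/-- Correctness of the search. A branch is closed without a labelling only if some element lies on
too few or too many blocks. -/
theorem search_sound {𝓑 : Finset (Finset (Fin 9))} (h : IsNineThree 𝓑) (n : ℕ) :
    ∀ rest chosen : List ℕ, search n rest chosen = true → (∀ m ∈ rest, m < 512) →
      (∀ m ∈ chosen, m < 512 ∧ support m ∈ 𝓑) → (rest ++ chosen).Nodup →
      (∀ m < 512, support m ∈ 𝓑 → m ∈ rest ++ chosen) →
      ∃ l : List ℕ, (∀ m ∈ l, support m ∈ 𝓑) ∧ labelled l = true := by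
  induction n with
  | zero => intro rest chosen hs; simp [search] at hs
  | succ n ih =>
    intro rest chosen hs hrest hchosen hnodup hall
    unfold search at hs
    rw [Bool.or_eq_true] at hs
    rcases hs with hs | hs
    · exfalso
      rw [isDeficient, List.any_eq_true] at hs
      obtain ⟨e, he, hs⟩ := hs
      obtain ⟨i, rfl⟩ := mem_elements.1 he
      have hlt : countThrough (2 ^ i.val) chosen + countThrough (2 ^ i.val) rest < 3 := by
        simpa [Nat.blt_eq] using hs
      rw [countThrough_two_pow, countThrough_two_pow] at hlt
      have hsub : 𝓑.filter (i ∈ ·) ⊆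
          (((rest ++ chosen).filter (fun m => i ∈ support m)).toFinset.image support) := by
        intro s hs
        rw [Finset.mem_filter] at hs
        obtain ⟨m, hm, rfl⟩ := exists_support_eq s
        refine Finset.mem_image_of_mem _ ?_
        rw [List.mem_toFinset, List.mem_filter]
        exact ⟨hall m hm hs.1, by simpa using hs.2⟩
      have h1 := (Finset.card_le_card hsub).trans
        (Finset.card_image_le.trans (List.toFinset_card_le _))
      rw [h.card_through, List.filter_append, List.length_append] at h1
      omega
    · match rest, hs, hrest, hnodup, hall with
      | [], hs, _, hnodup, _ =>
        rw [Bool.or_eq_true] at hs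
        rcases hs with hs | hs
        · exfalso
          rw [List.any_eq_true] at hs
          obtain ⟨e, he, hs⟩ := hs
          obtain ⟨i, rfl⟩ := mem_elements.1 he
          rw [Nat.blt_eq, countThrough_two_pow] at hs
          have hsub : ((chosen.filter (fun m => i ∈ support m)).toFinset.image support) ⊆
              𝓑.filter (i ∈ ·) := by
            intro s hs
            rw [Finset.mem_image] at hs
            obtain ⟨m, hm, rfl⟩ := hs
            rw [List.mem_toFinset, List.mem_filter] at hm
            exact Finset.mem_filter.2 ⟨(hchosen m hm.1).2, by simpa using hm.2⟩
          have h1 := Finset.card_le_card hsub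
          rw [Finset.card_image_of_injOn, List.toFinset_card_of_nodup, h.card_through] at h1
          · omega
          · exact (by simpa using hnodup : chosen.Nodup).filter _
          · intro m hm m' hm' heq
            simp only [List.coe_toFinset, List.mem_filter, Set.mem_ofPred_eq] at hm hm'
            exact support_injOn (hchosen m hm.1).1 (hchosen m' hm'.1).1 heq
        · exact ⟨chosen, fun m hm => (hchosen m hm).2, hs⟩
      | c :: rest, hs, hrest, hnodup, hall =>
        rw [Bool.and_eq_true] at hs
        rw [List.cons_append, List.nodup_cons] at hnodup
        have hc := hrest c List.mem_cons_self
        by_cases hcB : support c ∈ 𝓑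
        · refine ih _ _ hs.1 (fun m hm => hrest m (List.mem_cons_of_mem _ (List.mem_of_mem_filter hm)))
            ?_ ?_ ?_
          · intro m hm
            rcases List.mem_cons.1 hm with rfl | hm
            · exact ⟨hc, hcB⟩
            · exact hchosen m hm
          · rw [List.nodup_middle, List.nodup_cons]
            have hsub : (rest.filter (LineArrangement.compatible c) ++ chosen).Sublist
                (rest ++ chosen) := List.Sublist.append_right List.filter_sublist _
            exact ⟨fun hm => hnodup.1 (hsub.subset hm), hnodup.2.sublist hsub⟩
          · intro m hm hmB
            by_cases hmc : m = c
            · simp [hmc]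
            · have hmem := hall m hm hmB
              have hcomp := h.compatible hc hm hcB hmB (Ne.symm hmc)
              simp only [List.cons_append, List.mem_cons, List.mem_append, List.mem_filter] at hmem ⊢
              tauto
        · refine ih _ _ hs.2 (fun m hm => hrest m (List.mem_cons_of_mem _ hm)) hchosen hnodup.2 ?_
          intro m hm hmB
          refine (List.mem_cons.1 (hall m hm hmB)).resolve_left ?_
          rintro rfl
          exact hcB hmB

theorem support_add {a b c : Fin 9} (hab : a ≠ b) (hac : a ≠ c) (hbc : b ≠ c) :
    support (2 ^ a.val + (2 ^ b.val + 2 ^ c.val)) = {a, b, c} := by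
  revert a b c
  decide +kernel

theorem exists_perm_of_isLabelling {blocks : List (Fin 9 × Fin 9 × Fin 9)} {l s : List ℕ}
    (hb : ∀ b ∈ blocks, b.1 ≠ b.2.1 ∧ b.1 ≠ b.2.2 ∧ b.2.1 ≠ b.2.2)
    (h : isLabelling blocks l s = true) :
    ∃ σ : Equiv.Perm (Fin 9), ∀ b ∈ blocks, ∃ m ∈ l, support m = (blockSet b).map σ.toEmbedding := by
  rw [isLabelling, Bool.and_eq_true, Bool.and_eq_true, List.all_eq_true, List.all_eq_true] at h
  obtain ⟨hblocks, hlen, hs⟩ := h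
  have hlen : s.length = 9 := Nat.eq_of_beq_eq_true hlen
  have hf : ∀ i : Fin 9, ∃ k : Fin 9, s.getD k 0 = 2 ^ i.val := by
    intro i
    have h1 := hs (2 ^ i.val) (mem_elements.2 ⟨i, rfl⟩)
    rw [List.any_eq_true] at h1
    obtain ⟨x, hx, hxe⟩ := h1
    obtain ⟨k, hk, rfl⟩ := List.getElem_of_mem hx
    refine ⟨⟨k, by omega⟩, ?_⟩
    rw [List.getD_eq_getElem _ _ hk]
    exact (Nat.eq_of_beq_eq_true hxe).symm
  choose f hf using hf
  have hinj : Function.Injective f := by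
    intro i j hij
    have := (hf i).symm.trans (hij ▸ hf j)
    exact Fin.ext (Nat.pow_right_injective le_rfl this)
  let σ : Equiv.Perm (Fin 9) := (Equiv.ofBijective f (Finite.injective_iff_bijective.1 hinj)).symm
  have hσ : ∀ k : Fin 9, s.getD k 0 = 2 ^ (σ k).val := fun k => by
    rw [← hf (σ k)]
    exact congrArg (fun x : Fin 9 => s.getD x 0)
      ((Equiv.ofBijective f (Finite.injective_iff_bijective.1 hinj)).apply_symm_apply k).symm
  refine ⟨σ, fun b hbm => ?_⟩
  have h1 := hblocks b hbm
  rw [List.any_eq_true] at h1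
  obtain ⟨m, hm, hme⟩ := h1
  obtain ⟨h12, h13, h23⟩ := hb b hbm
  refine ⟨m, hm, ?_⟩
  rw [← Nat.eq_of_beq_eq_true hme, hσ, hσ, hσ]
  refine (support_add (σ.injective.ne h12) (σ.injective.ne h13) (σ.injective.ne h23)).trans ?_
  simp [blockSet]

theorem exists_isLabelling_of_labelled {l : List ℕ} (h : labelled l = true) :
    ∃ blocks ∈ [pappusBlocks, hexagonBlocks, cyclicBlocks], ∃ s, isLabelling blocks l s = true := by
  simp only [labelled, withElement, List.any_eq_true, Bool.and_eq_true, Bool.or_eq_true] at h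
  obtain ⟨a, -, b, -, d, -, -, c, -, -, e, -, -, f, -, -, h⟩ := h
  rcases h with ⟨i, -, -, k, -, -, g, -, -, h | h⟩ | ⟨i, -, -, k, -, -, g, -, -, h⟩
  · exact ⟨_, by simp, _, h⟩
  · exact ⟨_, by simp, _, h⟩
  · exact ⟨_, by simp, _, h⟩

/-- The classification for a configuration that contains the initial blocks. -/
theorem IsNineThree.exists_perm_of_initial {𝓑 : Finset (Finset (Fin 9))} (h : IsNineThree 𝓑)
    (hinit : ∀ m ∈ initialBlocks, support m ∈ 𝓑) :
    ∃ blocks ∈ [pappusBlocks, hexagonBlocks, cyclicBlocks], ∃ σ : Equiv.Perm (Fin 9),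
      ∀ b ∈ blocks, (blockSet b).map σ.toEmbedding ∈ 𝓑 := by
  have h0 : 𝓑.filter ((0 : Fin 9) ∈ ·) = {support 7, support 25, support 97} := by
    refine (Finset.eq_of_subset_of_card_le ?_ ?_).symm
    · intro s hs
      rw [Finset.mem_filter]
      simp only [Finset.mem_insert, Finset.mem_singleton] at hs
      rcases hs with rfl | rfl | rfl
      · exact ⟨hinit _ (by decide), by decide⟩
      · exact ⟨hinit _ (by decide), by decide⟩
      · exact ⟨hinit _ (by decide), by decide⟩
    · rw [h.card_through]
      decide
  have hlt : ∀ m ∈ initialBlocks, m < 512 := by decide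
  have hall : ∀ m < 512, support m ∈ 𝓑 → m ∈ candidateBlocks ++ initialBlocks := by
    intro m hm hmB
    rw [List.mem_append]
    by_cases hmi : m ∈ initialBlocks
    · exact Or.inr hmi
    left
    have hcard := h.card_block _ hmB
    have hm0 : Nat.land m (2 ^ 0) = 0 := by
      rw [land_two_pow_eq_zero]
      by_contra hcon
      have hmem : support m ∈ 𝓑.filter ((0 : Fin 9) ∈ ·) :=
        Finset.mem_filter.2 ⟨hmB, mem_support.2 (by simpa using hcon)⟩
      simp only [h0, Finset.mem_insert, Finset.mem_singleton] at hmem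
      rcases hmem with he | he | he
      · exact hmi (support_injOn hm (by norm_num) he ▸ by decide)
      · exact hmi (support_injOn hm (by norm_num) he ▸ by decide)
      · exact hmi (support_injOn hm (by norm_num) he ▸ by decide)
    rw [candidateBlocks, List.mem_filter, List.mem_reverse, List.mem_range, Bool.and_eq_true,
      Bool.and_eq_true, List.all_eq_true]
    refine ⟨hm, ⟨decide_eq_true hcard, ?_⟩, fun s hs => ?_⟩
    · rw [Nat.beq_eq]; exact hm0
    · exact h.compatible (hlt s hs) hm (hinit s hs) hmB (fun he => hmi (he ▸ hs))
  obtain ⟨l, hl, hlab⟩ := search_sound h 40 _ _ search_initialBlocks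
    (fun m hm => by
      rw [candidateBlocks, List.mem_filter, List.mem_reverse, List.mem_range] at hm
      exact hm.1)
    (fun m hm => ⟨hlt m hm, hinit m hm⟩) (by decide +kernel) hall
  obtain ⟨blocks, hblocks, s, hs⟩ := exists_isLabelling_of_labelled hlab
  have hne : ∀ blocks ∈ [pappusBlocks, hexagonBlocks, cyclicBlocks], ∀ b ∈ blocks,
      b.1 ≠ b.2.1 ∧ b.1 ≠ b.2.2 ∧ b.2.1 ≠ b.2.2 := by
    decide +kernel
  obtain ⟨σ, hσ⟩ := exists_perm_of_isLabelling (hne blocks hblocks) hs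
  refine ⟨blocks, hblocks, σ, fun b hb => ?_⟩
  obtain ⟨m, hm, hmb⟩ := hσ b hb
  exact hmb ▸ hl m hm

/-- Relabelling the elements of a configuration. -/
theorem IsNineThree.comap {𝓑 : Finset (Finset (Fin 9))} (h : IsNineThree 𝓑)
    (σ : Equiv.Perm (Fin 9)) :
    IsNineThree (Finset.univ.filter fun s => s.map σ.toEmbedding ∈ 𝓑) where
  card_block s hs := by
    rw [← h.card_block _ (Finset.mem_filter.1 hs).2, Finset.card_map]
  card_through i := by
    rw [← h.card_through (σ i)]
    refine Finset.card_bij (fun s _ => s.map σ.toEmbedding) ?_ ?_ ?_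
    · intro s hs
      simp only [Finset.mem_filter, Finset.mem_univ, true_and] at hs ⊢
      exact ⟨hs.1, Finset.mem_map_of_mem _ hs.2⟩
    · intro s _ t _ hst
      exact Finset.map_injective _ hst
    · intro t ht
      rw [Finset.mem_filter] at ht
      have hmap : (t.map σ.symm.toEmbedding).map σ.toEmbedding = t := by
        ext x; simp
      refine ⟨t.map σ.symm.toEmbedding, ?_, hmap⟩
      simp only [Finset.mem_filter, Finset.mem_univ, true_and, hmap]
      exact ⟨ht.1, by simpa using ht.2⟩
  eq_of_mem s hs t ht i j hij his hjs hit hjt := by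
    refine Finset.map_injective σ.toEmbedding
      (h.eq_of_mem _ (Finset.mem_filter.1 hs).2 _ (Finset.mem_filter.1 ht).2 (σ i) (σ j)
        (σ.injective.ne hij) ?_ ?_ ?_ ?_) <;>
    exact Finset.mem_map_of_mem _ ‹_›

/-- The third element of a block with two given elements. -/
theorem IsNineThree.exists_eq_insert {𝓑 : Finset (Finset (Fin 9))} (h : IsNineThree 𝓑)
    {s : Finset (Fin 9)} (hs : s ∈ 𝓑) {i j : Fin 9} (hij : i ≠ j) (hi : i ∈ s) (hj : j ∈ s) :
    ∃ k, s = {i, j, k} := by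
  have hcard := h.card_block s hs
  have h1 : ((s.erase i).erase j).card = 1 := by
    rw [Finset.card_erase_of_mem (Finset.mem_erase.2 ⟨hij.symm, hj⟩),
      Finset.card_erase_of_mem hi, hcard]
  obtain ⟨k, hk⟩ := Finset.card_eq_one.1 h1
  refine ⟨k, ?_⟩
  rw [← hk, Finset.insert_erase (Finset.mem_erase.2 ⟨hij.symm, hj⟩), Finset.insert_erase hi]

/-- Every configuration `(9₃)` contains the initial blocks of the search after a relabelling: the
element labelled `0` is arbitrary, `7` and `8` are the elements without a common block with `0`, and
`{1, 3, 7}` is a block through `7` that does not contain `8`. -/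
theorem IsNineThree.exists_initial {𝓑 : Finset (Finset (Fin 9))} (h : IsNineThree 𝓑) :
    ∃ σ : Equiv.Perm (Fin 9), ∀ m ∈ initialBlocks, (support m).map σ.toEmbedding ∈ 𝓑 := by
  obtain ⟨s₁, s₂, s₃, h12, h13, h23, hthrough⟩ := Finset.card_eq_three.1 (h.card_through 0)
  have hmem : ∀ s, s ∈ 𝓑 ∧ 0 ∈ s ↔ s = s₁ ∨ s = s₂ ∨ s = s₃ := fun s => by
    rw [← Finset.mem_filter (p := fun t : Finset (Fin 9) => 0 ∈ t), hthrough]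
    simp
  obtain ⟨hB1, h01⟩ := (hmem s₁).2 (by simp)
  obtain ⟨hB2, h02⟩ := (hmem s₂).2 (by simp)
  obtain ⟨hB3, h03⟩ := (hmem s₃).2 (by simp)
  have hdisj : ∀ s t, s ∈ 𝓑 → t ∈ 𝓑 → 0 ∈ s → 0 ∈ t → s ≠ t →
      Disjoint (s.erase 0) (t.erase 0) := by
    intro s t hs ht h0s h0t hst
    rw [Finset.disjoint_left]
    intro x hxs hxt
    rw [Finset.mem_erase] at hxs hxt
    exact hst (h.eq_of_mem s hs t ht 0 x hxs.1.symm h0s hxs.2 h0t hxt.2)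
  let U : Finset (Fin 9) := insert 0 ((s₁.erase 0 ∪ s₂.erase 0) ∪ s₃.erase 0)
  have hUcard : U.card = 7 := by
    rw [Finset.card_insert_of_notMem (by simp), Finset.card_union_of_disjoint,
      Finset.card_union_of_disjoint (hdisj _ _ hB1 hB2 h01 h02 h12),
      Finset.card_erase_of_mem h01, Finset.card_erase_of_mem h02, Finset.card_erase_of_mem h03,
      h.card_block _ hB1, h.card_block _ hB2, h.card_block _ hB3]
    rw [Finset.disjoint_union_left]
    exact ⟨hdisj _ _ hB1 hB3 h01 h03 h13, hdisj _ _ hB2 hB3 h02 h03 h23⟩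
  have hU : ∀ x, x ∈ U ↔ ∃ s ∈ 𝓑, 0 ∈ s ∧ x ∈ s := by
    intro x
    have : (∃ s ∈ 𝓑, 0 ∈ s ∧ x ∈ s) ↔ x ∈ s₁ ∨ x ∈ s₂ ∨ x ∈ s₃ := by
      constructor
      · rintro ⟨s, hs, h0, hx⟩
        rcases (hmem s).1 ⟨hs, h0⟩ with rfl | rfl | rfl <;> tauto
      · rintro (hx | hx | hx)
        exacts [⟨_, hB1, h01, hx⟩, ⟨_, hB2, h02, hx⟩, ⟨_, hB3, h03, hx⟩]
    rw [this]
    simp only [U, Finset.mem_insert, Finset.mem_union, Finset.mem_erase]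
    by_cases hx : x = 0
    · simp [hx, h01]
    · simp [hx, or_assoc]
  have hUc : (Uᶜ).card = 2 := by
    rw [Finset.card_compl, hUcard]; rfl
  obtain ⟨g, k, hgk, hUgk⟩ := Finset.card_eq_two.1 hUc
  have hg : g ∉ U := by
    rw [← Finset.mem_compl, hUgk]; simp
  -- at most one of the three blocks through `g` contains `k`
  obtain ⟨t, htB, hgt, hkt⟩ : ∃ t ∈ 𝓑, g ∈ t ∧ k ∉ t := by
    by_contra! hcon
    have h1 : 1 < (𝓑.filter (g ∈ ·)).card := by rw [h.card_through]; norm_num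
    obtain ⟨t, ht, t', ht', hne⟩ := Finset.one_lt_card.1 h1
    rw [Finset.mem_filter] at ht ht'
    exact hne (h.eq_of_mem t ht.1 t' ht'.1 g k hgk ht.2 (hcon t ht.1 ht.2) ht'.2
      (hcon t' ht'.1 ht'.2))
  have h0t : 0 ∉ t := fun h0 => hg ((hU g).2 ⟨t, htB, h0, hgt⟩)
  have hcard2 : (t.erase g).card = 2 := by
    rw [Finset.card_erase_of_mem hgt, h.card_block t htB]
  obtain ⟨y, z, hyz, htyz⟩ := Finset.card_eq_two.1 hcard2
  have hty : y ∈ t.erase g := by rw [htyz]; simp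
  have htz : z ∈ t.erase g := by rw [htyz]; simp
  have ht : t = {y, z, g} := by
    rw [← Finset.insert_erase hgt, htyz]
    ext; simp; tauto
  have hjoin : ∀ x ∈ t.erase g, ∃ s ∈ 𝓑, 0 ∈ s ∧ x ∈ s := by
    intro x hx
    rw [← hU]
    by_contra hxU
    rw [← Finset.mem_compl, hUgk, Finset.mem_insert, Finset.mem_singleton] at hxU
    rw [Finset.mem_erase] at hx
    rcases hxU with rfl | rfl
    · exact hx.1 rfl
    · exact hkt hx.2
  obtain ⟨s, hsB, h0s, hys⟩ := hjoin y hty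
  obtain ⟨s', hsB', h0s', hzs'⟩ := hjoin z htz
  rw [Finset.mem_erase] at hty htz
  have hss' : s ≠ s' := by
    rintro rfl
    exact h0t (h.eq_of_mem s hsB t htB y z hyz hys hzs' hty.2 htz.2 ▸ h0s)
  have h1 : (((𝓑.filter ((0 : Fin 9) ∈ ·)).erase s).erase s').card = 1 := by
    rw [Finset.card_erase_of_mem, Finset.card_erase_of_mem, h.card_through]
    · simp [hsB, h0s]
    · simp [hss'.symm, hsB', h0s']
  obtain ⟨s'', hs''⟩ := Finset.card_eq_one.1 h1
  have hall : ∀ r, r ∈ 𝓑 ∧ 0 ∈ r → r = s ∨ r = s' ∨ r = s'' := by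
    intro r hr
    by_contra! hcon
    have : r ∈ ((𝓑.filter ((0 : Fin 9) ∈ ·)).erase s).erase s' := by
      simp [hcon, hr]
    rw [hs'', Finset.mem_singleton] at this
    exact hcon.2.2 this
  have hs3 : s'' ∈ ((𝓑.filter ((0 : Fin 9) ∈ ·)).erase s).erase s' := by rw [hs'']; simp
  simp only [Finset.mem_erase, Finset.mem_filter] at hs3
  obtain ⟨-, -, hsB'', h0s''⟩ := hs3
  have hy0 : (0 : Fin 9) ≠ y := fun h0 => h0t (h0 ▸ hty.2)
  have hz0 : (0 : Fin 9) ≠ z := fun h0 => h0t (h0 ▸ htz.2)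
  obtain ⟨b, hb⟩ := h.exists_eq_insert hsB hy0 h0s hys
  obtain ⟨d, hd⟩ := h.exists_eq_insert hsB' hz0 h0s' hzs'
  obtain ⟨e, he0, hes⟩ : ∃ e, (0 : Fin 9) ≠ e ∧ e ∈ s'' := by
    have : (s''.erase 0).Nonempty := by
      rw [← Finset.card_pos, Finset.card_erase_of_mem h0s'', h.card_block _ hsB'']
      norm_num
    obtain ⟨e, he⟩ := this
    rw [Finset.mem_erase] at he
    exact ⟨e, he.1.symm, he.2⟩
  obtain ⟨f, hf⟩ := h.exists_eq_insert hsB'' he0 h0s'' hes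
  have hsurj : Function.Surjective ![0, y, b, z, d, e, f, g, k] := by
    intro x
    by_cases hx : x ∈ U
    · obtain ⟨r, hrB, h0r, hxr⟩ := (hU x).1 hx
      rcases hall r ⟨hrB, h0r⟩ with rfl | rfl | rfl
      · rw [hb] at hxr
        simp only [Finset.mem_insert, Finset.mem_singleton] at hxr
        rcases hxr with rfl | rfl | rfl
        exacts [⟨0, rfl⟩, ⟨1, rfl⟩, ⟨2, rfl⟩]
      · rw [hd] at hxr
        simp only [Finset.mem_insert, Finset.mem_singleton] at hxr
        rcases hxr with rfl | rfl | rfl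
        exacts [⟨0, rfl⟩, ⟨3, rfl⟩, ⟨4, rfl⟩]
      · rw [hf] at hxr
        simp only [Finset.mem_insert, Finset.mem_singleton] at hxr
        rcases hxr with rfl | rfl | rfl
        exacts [⟨0, rfl⟩, ⟨5, rfl⟩, ⟨6, rfl⟩]
    · rw [← Finset.mem_compl, hUgk, Finset.mem_insert, Finset.mem_singleton] at hx
      rcases hx with rfl | rfl
      exacts [⟨7, rfl⟩, ⟨8, rfl⟩]
  refine ⟨Equiv.ofBijective _ (Finite.surjective_iff_bijective.1 hsurj), ?_⟩
  have e1 : support 7 = {0, 1, 2} := by decide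
  have e2 : support 25 = {0, 3, 4} := by decide
  have e3 : support 97 = {0, 5, 6} := by decide
  have e4 : support 138 = {1, 3, 7} := by decide
  intro m hm
  simp only [initialBlocks, List.mem_cons, List.not_mem_nil, or_false] at hm
  rcases hm with rfl | rfl | rfl | rfl
  · rw [e1]
    simpa [Finset.map_insert] using hb ▸ hsB
  · rw [e2]
    simpa [Finset.map_insert] using hd ▸ hsB'
  · rw [e3]
    simpa [Finset.map_insert] using hf ▸ hsB''
  · rw [e4]
    simpa [Finset.map_insert] using ht ▸ htB

/-- A configuration `(9₃)` is, up to a relabelling, one of the three model configurations. -/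
theorem IsNineThree.exists_perm {𝓑 : Finset (Finset (Fin 9))} (h : IsNineThree 𝓑) :
    ∃ blocks ∈ [pappusBlocks, hexagonBlocks, cyclicBlocks], ∃ σ : Equiv.Perm (Fin 9),
      ∀ b ∈ blocks, (blockSet b).map σ.toEmbedding ∈ 𝓑 := by
  obtain ⟨σ, hσ⟩ := h.exists_initial
  obtain ⟨blocks, hblocks, τ, hτ⟩ := (h.comap σ).exists_perm_of_initial
    (fun m hm => Finset.mem_filter.2 ⟨Finset.mem_univ _, hσ m hm⟩)
  refine ⟨blocks, hblocks, τ.trans σ, fun b hb => ?_⟩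
  have := (Finset.mem_filter.1 (hτ b hb)).2
  rwa [Finset.map_map] at this

/-! ### Normal forms of the realizations of the three configurations -/

/-- The dependent triples of distinct vectors of `w` are exactly the blocks. -/
structure Realizes (blocks : List (Fin 9 × Fin 9 × Fin 9)) (w : Fin 9 → Fin 3 → ℂ) : Prop where
  det_eq_zero : ∀ b ∈ blocks, tripleDet (w b.1) (w b.2.1) (w b.2.2) = 0
  det_ne_zero : ∀ b : Fin 9 × Fin 9 × Fin 9, b.1 ≠ b.2.1 → b.1 ≠ b.2.2 → b.2.1 ≠ b.2.2 →
    (∀ b' ∈ blocks, blockSet b ≠ blockSet b') → tripleDet (w b.1) (w b.2.1) (w b.2.2) ≠ 0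

theorem Realizes.of_smul {blocks : List (Fin 9 × Fin 9 × Fin 9)} {w u : Fin 9 → Fin 3 → ℂ}
    (h : Realizes blocks w) (N : GL (Fin 3) ℂ) (c : Fin 9 → ℂ) (hc : ∀ i, c i ≠ 0)
    (hN : ∀ i, N.1 *ᵥ w i = c i • u i) : Realizes blocks u := by
  have hd : N.1.det ≠ 0 := ((Matrix.isUnit_iff_isUnit_det _).1 N.isUnit).ne_zero
  have key : ∀ i j k, tripleDet (u i) (u j) (u k) = 0 ↔ tripleDet (w i) (w j) (w k) = 0 := by
    intro i j k
    have h1 := tripleDet_mulVec N.1 (w i) (w j) (w k)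
    rw [hN, hN, hN, tripleDet_smul] at h1
    have hc3 := mul_ne_zero (mul_ne_zero (hc i) (hc j)) (hc k)
    constructor <;> intro h0 <;> rw [h0, mul_zero] at h1
    · exact (mul_eq_zero.1 h1.symm).resolve_left hd
    · exact (mul_eq_zero.1 h1).resolve_left hc3
  exact ⟨fun b hb => (key _ _ _).2 (h.1 b hb),
    fun b h1 h2 h3 h4 h5 => h.2 b h1 h2 h3 h4 ((key _ _ _).1 h5)⟩

/-- Coordinates in which a triangle `a`, `b`, `c`, a point `p` of the side `ab` and a point `q` of
the side `bc` become standard. -/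
theorem exists_frame (a b c p q : Fin 3 → ℂ) (habc : tripleDet a b c ≠ 0)
    (habp : tripleDet a b p = 0) (hbcq : tripleDet b c q = 0) (hpbc : tripleDet p b c ≠ 0)
    (hapc : tripleDet a p c ≠ 0) (haqc : tripleDet a q c ≠ 0) (habq : tripleDet a b q ≠ 0) :
    ∃ N : GL (Fin 3) ℂ, (∃ r : ℂ, r ≠ 0 ∧ N.1 *ᵥ a = r • ![1, 0, 0]) ∧
      (∃ r : ℂ, r ≠ 0 ∧ N.1 *ᵥ b = r • ![0, 1, 0]) ∧ (∃ r : ℂ, r ≠ 0 ∧ N.1 *ᵥ c = r • ![0, 0, 1]) ∧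
      (∃ r : ℂ, r ≠ 0 ∧ N.1 *ᵥ p = r • ![1, 1, 0]) ∧ (∃ r : ℂ, r ≠ 0 ∧ N.1 *ᵥ q = r • ![0, 1, 1]) := by
  -- the coordinates of `x` in the basis `a`, `b`, `c` are the determinants of Cramer's rule; they
  -- are rescaled so that `p` and `q` get equal coordinates
  let N (l m n : ℂ) : Matrix (Fin 3) (Fin 3) ℂ :=
    Matrix.of ![l • crossProduct b c, m • crossProduct c a, n • crossProduct a b]
  have hN : ∀ l m n x, N l m n *ᵥ x =
      ![l * tripleDet x b c, m * tripleDet a x c, n * tripleDet a b x] := by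
    intro l m n x
    ext i
    fin_cases i <;>
    simp [N, Matrix.mulVec, dotProduct, Fin.sum_univ_three, tripleDet_expand, cross_apply] <;>
    ring
  have hdet : ∀ l m n, (N l m n).det = l * m * n * tripleDet a b c ^ 2 := by
    intro l m n
    simp [N, Matrix.det_fin_three, tripleDet_expand, cross_apply]
    ring
  have self1 : ∀ x y : Fin 3 → ℂ, tripleDet x x y = 0 := fun x y => by
    rw [tripleDet_expand]; ring
  have self2 : ∀ x y : Fin 3 → ℂ, tripleDet y x x = 0 := fun x y => by
    rw [tripleDet_expand]; ring
  have self3 : ∀ x y : Fin 3 → ℂ, tripleDet x y x = 0 := fun x y => by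
    rw [tripleDet_expand]; ring
  have hqbc : tripleDet q b c = 0 := by
    rw [← hbcq, tripleDet_expand, tripleDet_expand]; ring
  set l := tripleDet a p c * tripleDet a b q
  set m := tripleDet p b c * tripleDet a b q
  set n := tripleDet p b c * tripleDet a q c
  have hl : l ≠ 0 := mul_ne_zero hapc habq
  have hm : m ≠ 0 := mul_ne_zero hpbc habq
  have hn : n ≠ 0 := mul_ne_zero hpbc haqc
  refine ⟨Matrix.GeneralLinearGroup.mkOfDetNeZero (N l m n) ?_, ?_, ?_, ?_, ?_, ?_⟩
  · rw [hdet]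
    exact mul_ne_zero (mul_ne_zero (mul_ne_zero hl hm) hn) (pow_ne_zero _ habc)
  · refine ⟨l * tripleDet a b c, mul_ne_zero hl habc, (hN ..).trans ?_⟩
    simp [self1, self3]
  · refine ⟨m * tripleDet a b c, mul_ne_zero hm habc, (hN ..).trans ?_⟩
    simp [self1, self2]
  · refine ⟨n * tripleDet a b c, mul_ne_zero hn habc, (hN ..).trans ?_⟩
    simp [self2, self3]
  · refine ⟨l * tripleDet p b c, mul_ne_zero hl hpbc, (hN ..).trans ?_⟩
    simp only [habp, mul_zero, smul_cons, smul_eq_mul, mul_one, smul_empty, l, m]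
    ext i; fin_cases i <;> simp
    ring
  · refine ⟨m * tripleDet a q c, mul_ne_zero hm haqc, (hN ..).trans ?_⟩
    simp only [hqbc, mul_zero, smul_cons, smul_eq_mul, mul_one, smul_empty, n, m]
    ext i; fin_cases i <;> simp
    ring

/-- Nine vectors in normalized coordinates: the standard triangle, one point on each of its sides,
of which two are fixed by the choice of the coordinates, and three further vectors. -/
def frameVectors (z₅ y₆ z₆ y₇ z₇ y₈ z₈ : ℂ) : Fin 9 → Fin 3 → ℂ :=
  ![![1, 0, 0], ![0, 1, 0], ![0, 0, 1], ![1, 1, 0], ![0, 1, 1], ![1, 0, z₅], ![1, y₆, z₆],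
    ![1, y₇, z₇], ![1, y₈, z₈]]

/-- Normalized coordinates for a realization. The hypothesis `hfree` lists the independent triples
that are needed: `0`, `1`, `2` form a triangle, `3` and `4` are not among its vertices, and `5`, `6`,
`7`, `8` do not lie on the side through `1` and `2`, so that their first coordinate can be scaled to
`1`. -/
theorem Realizes.exists_frameVectors {blocks : List (Fin 9 × Fin 9 × Fin 9)}
    {w : Fin 9 → Fin 3 → ℂ} (h : Realizes blocks w)
    (hblocks : ∀ b ∈ [((0 : Fin 9), (1 : Fin 9), (3 : Fin 9)), (1, 2, 4), (0, 2, 5)], b ∈ blocks)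
    (hfree : ∀ b ∈ [((0 : Fin 9), (1 : Fin 9), (2 : Fin 9)), (3, 1, 2), (0, 3, 2), (0, 4, 2),
      (0, 1, 4), (5, 1, 2), (6, 1, 2), (7, 1, 2), (8, 1, 2)],
        ∀ b' ∈ blocks, blockSet b ≠ blockSet b') :
    ∃ (N : GL (Fin 3) ℂ) (z₅ y₆ z₆ y₇ z₇ y₈ z₈ : ℂ),
      Realizes blocks (frameVectors z₅ y₆ z₆ y₇ z₇ y₈ z₈) ∧
      ∀ i, ∃ c : ℂ, c ≠ 0 ∧ N.1 *ᵥ w i = c • frameVectors z₅ y₆ z₆ y₇ z₇ y₈ z₈ i := by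
  obtain ⟨N, ⟨r₀, hr₀, h₀⟩, ⟨r₁, hr₁, h₁⟩, ⟨r₂, hr₂, h₂⟩, ⟨r₃, hr₃, h₃⟩, ⟨r₄, hr₄, h₄⟩⟩ :=
    exists_frame (w 0) (w 1) (w 2) (w 3) (w 4)
      (h.2 (0, 1, 2) (by decide) (by decide) (by decide) (hfree _ (by simp)))
      (h.1 (0, 1, 3) (hblocks _ (by simp))) (h.1 (1, 2, 4) (hblocks _ (by simp)))
      (h.2 (3, 1, 2) (by decide) (by decide) (by decide) (hfree _ (by simp)))
      (h.2 (0, 3, 2) (by decide) (by decide) (by decide) (hfree _ (by simp)))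
      (h.2 (0, 4, 2) (by decide) (by decide) (by decide) (hfree _ (by simp)))
      (h.2 (0, 1, 4) (by decide) (by decide) (by decide) (hfree _ (by simp)))
  have hdN : N.1.det ≠ 0 := ((Matrix.isUnit_iff_isUnit_det _).1 N.isUnit).ne_zero
  -- points off the line through `w 1` and `w 2` have nonzero first coordinate
  have hx : ∀ i, tripleDet (w i) (w 1) (w 2) ≠ 0 → (N.1 *ᵥ w i) 0 ≠ 0 ∧
      N.1 *ᵥ w i = (N.1 *ᵥ w i) 0 • ![1, (N.1 *ᵥ w i) 1 / (N.1 *ᵥ w i) 0,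
        (N.1 *ᵥ w i) 2 / (N.1 *ᵥ w i) 0] := by
    intro i hi
    have h0 : (N.1 *ᵥ w i) 0 ≠ 0 := by
      intro h0
      have := tripleDet_mulVec N.1 (w i) (w 1) (w 2)
      rw [h₁, h₂, tripleDet_expand] at this
      simp [h0] at this
      exact this.elim hdN hi
    refine ⟨h0, ?_⟩
    ext j
    fin_cases j
    · simp
    · simp; field_simp
    · simp; field_simp
  obtain ⟨h50, h5⟩ := hx 5 (h.2 (5, 1, 2) (by decide) (by decide) (by decide) (hfree _ (by simp)))
  obtain ⟨h60, h6⟩ := hx 6 (h.2 (6, 1, 2) (by decide) (by decide) (by decide) (hfree _ (by simp)))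
  obtain ⟨h70, h7⟩ := hx 7 (h.2 (7, 1, 2) (by decide) (by decide) (by decide) (hfree _ (by simp)))
  obtain ⟨h80, h8⟩ := hx 8 (h.2 (8, 1, 2) (by decide) (by decide) (by decide) (hfree _ (by simp)))
  have h51 : (N.1 *ᵥ w 5) 1 = 0 := by
    have h3 := tripleDet_mulVec N.1 (w 0) (w 2) (w 5)
    rw [h.1 (0, 2, 5) (hblocks _ (by simp)), h₀, h₂, tripleDet_expand] at h3
    simpa [hr₀, hr₂] using h3
  rw [h51, zero_div] at h5
  have hall : ∀ i, ∃ c : ℂ, c ≠ 0 ∧ N.1 *ᵥ w i = c • frameVectors ((N.1 *ᵥ w 5) 2 / (N.1 *ᵥ w 5) 0)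
      ((N.1 *ᵥ w 6) 1 / (N.1 *ᵥ w 6) 0) ((N.1 *ᵥ w 6) 2 / (N.1 *ᵥ w 6) 0)
      ((N.1 *ᵥ w 7) 1 / (N.1 *ᵥ w 7) 0) ((N.1 *ᵥ w 7) 2 / (N.1 *ᵥ w 7) 0)
      ((N.1 *ᵥ w 8) 1 / (N.1 *ᵥ w 8) 0) ((N.1 *ᵥ w 8) 2 / (N.1 *ᵥ w 8) 0) i := by
    intro i
    fin_cases i
    exacts [⟨r₀, hr₀, h₀⟩, ⟨r₁, hr₁, h₁⟩, ⟨r₂, hr₂, h₂⟩, ⟨r₃, hr₃, h₃⟩, ⟨r₄, hr₄, h₄⟩,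
      ⟨_, h50, h5⟩, ⟨_, h60, h6⟩, ⟨_, h70, h7⟩, ⟨_, h80, h8⟩]
  choose c hc hcN using hall
  exact ⟨N, _, _, _, _, _, _, _, h.of_smul N c hc hcN, fun i => ⟨c i, hc i, hcN i⟩⟩

/-- A polynomial parametrization, up to projective equivalence, of all realizations of a
configuration. -/
def HasParametrization (blocks : List (Fin 9 × Fin 9 × Fin 9)) : Prop :=
  ∃ (n : ℕ) (v : Fin 9 → Fin 3 → MvPolynomial (Fin n) ℂ),
    (∀ b ∈ blocks, tripleDet (v b.1) (v b.2.1) (v b.2.2) = 0) ∧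
    ∀ w, Realizes blocks w → ∃ (t : Fin n → ℂ) (N : GL (Fin 3) ℂ), ∀ i, ∃ c : ℂ,
      c ≠ 0 ∧ N.1 *ᵥ w i = c • fun j => MvPolynomial.eval t (v i j)

/-- To parametrize all realizations it suffices to parametrize the ones in normalized
coordinates. -/
theorem hasParametrization_of_frameVectors {blocks : List (Fin 9 × Fin 9 × Fin 9)}
    (hblocks : ∀ b ∈ [((0 : Fin 9), (1 : Fin 9), (3 : Fin 9)), (1, 2, 4), (0, 2, 5)], b ∈ blocks)
    (hfree : ∀ b ∈ [((0 : Fin 9), (1 : Fin 9), (2 : Fin 9)), (3, 1, 2), (0, 3, 2), (0, 4, 2),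
      (0, 1, 4), (5, 1, 2), (6, 1, 2), (7, 1, 2), (8, 1, 2)],
        ∀ b' ∈ blocks, blockSet b ≠ blockSet b')
    {n : ℕ} (v : Fin 9 → Fin 3 → MvPolynomial (Fin n) ℂ)
    (hdep : ∀ b ∈ blocks, tripleDet (v b.1) (v b.2.1) (v b.2.2) = 0)
    (hsolve : ∀ z₅ y₆ z₆ y₇ z₇ y₈ z₈, Realizes blocks (frameVectors z₅ y₆ z₆ y₇ z₇ y₈ z₈) →
      ∃ t : Fin n → ℂ, ∀ i, ∃ c : ℂ, c ≠ 0 ∧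
        frameVectors z₅ y₆ z₆ y₇ z₇ y₈ z₈ i = c • fun j => MvPolynomial.eval t (v i j)) :
    HasParametrization blocks := by
  refine ⟨n, v, hdep, fun w hw => ?_⟩
  obtain ⟨N, z₅, y₆, z₆, y₇, z₇, y₈, z₈, hr, hN⟩ := hw.exists_frameVectors hblocks hfree
  obtain ⟨t, ht⟩ := hsolve _ _ _ _ _ _ _ hr
  refine ⟨t, N, fun i => ?_⟩
  obtain ⟨c, hc, hci⟩ := hN i
  obtain ⟨d, hd, hdi⟩ := ht i
  exact ⟨c * d, mul_ne_zero hc hd, by rw [hci, hdi, smul_smul]⟩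

/-- The realizations of the Pappus configuration in normalized coordinates. -/
def pappusVectors {R : Type*} [CommRing R] (u v : R) : Fin 9 → Fin 3 → R :=
  ![![1, 0, 0], ![0, 1, 0], ![0, 0, 1], ![1, 1, 0], ![0, 1, 1], ![1, 0, u],
    ![1, 1 + v, -(u * v)], ![1, 1 + v, v], ![1, -(u * (1 + v)), -(u * v)]]

/-- The realizations of the hexagon configuration in normalized coordinates. -/
def hexagonVectors {R : Type*} [CommRing R] (u : R) : Fin 9 → Fin 3 → R :=
  ![![1, 0, 0], ![0, 1, 0], ![0, 0, 1], ![1, 1, 0], ![0, 1, 1], ![1, 0, u],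
    ![1, u, u - 1], ![1, u, -(u * (u - 1))], ![1, -1, u - 1]]

/-- The realizations of the cyclic configuration in normalized coordinates. They form a conic, which
is parametrized by the lines through one of its points. -/
def cyclicVectors {R : Type*} [CommRing R] (k : R) : Fin 9 → Fin 3 → R :=
  ![![1, 0, 0], ![0, 1, 0], ![0, 0, 1], ![1, 1, 0], ![0, 1, 1], ![1 + k + k ^ 2, 0, k],
    ![1 + k + k ^ 2, 1 + k + k ^ 2, k + k ^ 2], ![1, 1 + k, k], ![1 + k + k ^ 2, 1 + k, k]]

theorem pappusVectors_dependent {R : Type*} [CommRing R] (u v : R) :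
    ∀ b ∈ pappusBlocks, tripleDet (pappusVectors u v b.1) (pappusVectors u v b.2.1)
      (pappusVectors u v b.2.2) = 0 := by
  intro b hb
  simp only [pappusBlocks, List.mem_cons, List.not_mem_nil, or_false] at hb
  rcases hb with rfl | rfl | rfl | rfl | rfl | rfl | rfl | rfl | rfl <;>
  simp [pappusVectors, tripleDet_expand] <;>
  ring

theorem hexagonVectors_dependent {R : Type*} [CommRing R] (u : R) :
    ∀ b ∈ hexagonBlocks, tripleDet (hexagonVectors u b.1) (hexagonVectors u b.2.1)
      (hexagonVectors u b.2.2) = 0 := by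
  intro b hb
  simp only [hexagonBlocks, List.mem_cons, List.not_mem_nil, or_false] at hb
  rcases hb with rfl | rfl | rfl | rfl | rfl | rfl | rfl | rfl | rfl <;>
  simp [hexagonVectors, tripleDet_expand]
  ring

theorem cyclicVectors_dependent {R : Type*} [CommRing R] (k : R) :
    ∀ b ∈ cyclicBlocks, tripleDet (cyclicVectors k b.1) (cyclicVectors k b.2.1)
      (cyclicVectors k b.2.2) = 0 := by
  intro b hb
  simp only [cyclicBlocks, List.mem_cons, List.not_mem_nil, or_false] at hb
  rcases hb with rfl | rfl | rfl | rfl | rfl | rfl | rfl | rfl | rfl <;>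
  simp [cyclicVectors, tripleDet_expand] <;>
  ring

theorem hasParametrization_pappusBlocks : HasParametrization pappusBlocks := by
  refine hasParametrization_of_frameVectors (by decide +kernel) (by decide +kernel)
    (pappusVectors (MvPolynomial.X (R := ℂ) (0 : Fin 2)) (MvPolynomial.X 1))
    (pappusVectors_dependent _ _) ?_
  intro z₅ y₆ z₆ y₇ z₇ y₈ z₈ h
  have h267 := h.1 (2, 6, 7) (by decide)
  have h168 := h.1 (1, 6, 8) (by decide)
  have h356 := h.1 (3, 5, 6) (by decide)
  have h347 := h.1 (3, 4, 7) (by decide)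
  have h458 := h.1 (4, 5, 8) (by decide)
  simp [frameVectors, tripleDet_expand] at h267 h168 h356 h347 h458
  have hy₇ : y₇ = 1 + z₇ := by linear_combination -h347
  have hy₆ : y₆ = 1 + z₇ := by linear_combination hy₇ - h267
  have hz₆ : z₆ = -(z₅ * z₇) := by linear_combination -h356 - z₅ * hy₆
  have hz₈ : z₈ = -(z₅ * z₇) := by linear_combination hz₆ - h168
  have hy₈ : y₈ = -(z₅ * (1 + z₇)) := by linear_combination h458 + hz₈
  refine ⟨![z₅, z₇], fun i => ⟨1, one_ne_zero, ?_⟩⟩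
  rw [hy₇, hy₆, hz₆, hz₈, hy₈, one_smul]
  fin_cases i <;> ext j <;> fin_cases j <;> simp [frameVectors, pappusVectors]

theorem hasParametrization_hexagonBlocks : HasParametrization hexagonBlocks := by
  refine hasParametrization_of_frameVectors (by decide +kernel) (by decide +kernel)
    (hexagonVectors (MvPolynomial.X (R := ℂ) (0 : Fin 1)))
    (hexagonVectors_dependent _) ?_
  intro z₅ y₆ z₆ y₇ z₇ y₈ z₈ h
  have h267 := h.1 (2, 6, 7) (by decide)
  have h168 := h.1 (1, 6, 8) (by decide)
  have h357 := h.1 (3, 5, 7) (by decide)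
  have h346 := h.1 (3, 4, 6) (by decide)
  have h458 := h.1 (4, 5, 8) (by decide)
  have h078 := h.1 (0, 7, 8) (by decide)
  have h016 := h.2 (0, 1, 6) (by decide) (by decide) (by decide) (by decide +kernel)
  have h345 := h.2 (3, 4, 5) (by decide) (by decide) (by decide) (by decide +kernel)
  simp [frameVectors, tripleDet_expand] at h267 h168 h357 h346 h458 h078 h016 h345
  have hy₆ : y₆ = 1 + z₆ := by linear_combination -h346
  have hy₇ : y₇ = 1 + z₆ := by linear_combination h267 + hy₆
  have hz₈ : z₈ = z₆ := by linear_combination -h168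
  have hz₇ : z₇ = -(z₅ * z₆) := by linear_combination -h357 - z₅ * hy₇
  have hy₈ : y₈ = z₆ - z₅ := by linear_combination h458 + hz₈
  have hz₆ : z₆ = z₅ - 1 := by
    have h1 : z₆ * ((z₅ + 1) * (z₆ - (z₅ - 1))) = 0 := by
      rw [hy₇, hz₈, hz₇, hy₈] at h078
      linear_combination h078
    have h2 : z₅ + 1 ≠ 0 := fun h0 => h345 (by linear_combination h0)
    linear_combination (mul_eq_zero.1 ((mul_eq_zero.1 h1).resolve_left h016)).resolve_left h2
  refine ⟨![z₅], fun i => ⟨1, one_ne_zero, ?_⟩⟩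
  rw [hy₇, hy₆, hz₇, hz₈, hy₈, hz₆, one_smul]
  fin_cases i <;> ext j <;> fin_cases j <;> simp [frameVectors, hexagonVectors]

theorem hasParametrization_cyclicBlocks : HasParametrization cyclicBlocks := by
  refine hasParametrization_of_frameVectors (by decide +kernel) (by decide +kernel)
    (cyclicVectors (MvPolynomial.X (R := ℂ) (0 : Fin 1)))
    (cyclicVectors_dependent _) ?_
  intro z₅ y₆ z₆ y₇ z₇ y₈ z₈ h
  have h236 := h.1 (2, 3, 6) (by decide)
  have h347 := h.1 (3, 4, 7) (by decide)
  have h078 := h.1 (0, 7, 8) (by decide)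
  have h158 := h.1 (1, 5, 8) (by decide)
  have h468 := h.1 (4, 6, 8) (by decide)
  have h567 := h.1 (5, 6, 7) (by decide)
  have h015 := h.2 (0, 1, 5) (by decide) (by decide) (by decide) (by decide +kernel)
  simp [frameVectors, tripleDet_expand] at h236 h347 h078 h158 h468 h567 h015
  have hy₆ : y₆ = 1 := by linear_combination h236
  have hz₈ : z₈ = z₅ := by linear_combination -h158
  have hz₇ : z₇ = y₇ - 1 := by linear_combination h347
  -- the parameter is the slope of the line through the origin and the point `(z₅, z₆ - z₅)` of the
  -- conic
  obtain ⟨k, hk⟩ : ∃ k, z₆ = z₅ * (1 + k) := ⟨z₆ / z₅ - 1, by field_simp; ring⟩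
  have hy₈ : y₈ = 1 - z₅ * k := by
    linear_combination h468 + hz₈ - hk + hy₆
  have hy₇ : y₇ = 1 + k := by
    have h1 : z₅ * (y₇ - (1 + k)) = 0 := by
      rw [hz₇, hy₈, hz₈] at h078
      rw [hy₆, hz₇, hk] at h567
      linear_combination h078 + h567
    linear_combination (mul_eq_zero.1 h1).resolve_left h015
  have hz₅ : z₅ * (1 + k + k ^ 2) = k := by
    rw [hy₆, hz₇, hk, hy₇] at h567
    linear_combination -h567
  have hq : 1 + k + k ^ 2 ≠ 0 := by
    intro h0
    have hk0 : k = 0 := by rw [← hz₅, h0, mul_zero]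
    simp [hk0] at h0
  have hz₅' : z₅ = (1 + k + k ^ 2)⁻¹ * k := by
    field_simp
    linear_combination hz₅
  have hc : ∀ i, (![1, 1, 1, 1, 1, (1 + k + k ^ 2)⁻¹, (1 + k + k ^ 2)⁻¹, 1, (1 + k + k ^ 2)⁻¹] :
      Fin 9 → ℂ) i ≠ 0 := by
    intro i
    fin_cases i <;> simp [hq]
  refine ⟨![k], fun i => ⟨_, hc i, ?_⟩⟩
  rw [hk, hy₇, hy₆, hz₇, hz₈, hy₈, hz₅', hy₇]
  fin_cases i <;> ext j <;> fin_cases j <;> simp [frameVectors, cyclicVectors] <;> field_simp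
  ring

/-! ### The configuration of triple points -/

theorem hasParametrization_of_mem {blocks : List (Fin 9 × Fin 9 × Fin 9)}
    (h : blocks ∈ [pappusBlocks, hexagonBlocks, cyclicBlocks]) : HasParametrization blocks := by
  simp only [List.mem_cons, List.not_mem_nil, or_false] at h
  rcases h with rfl | rfl | rfl
  exacts [hasParametrization_pappusBlocks, hasParametrization_hexagonBlocks,
    hasParametrization_cyclicBlocks]

open Classical in
/-- The indices of the lines through a point. -/
noncomputable def linesThrough {n : ℕ} (A : Fin n → DualP2) (P : P2) : Finset (Fin n) :=
  Finset.univ.filter fun i => P ∈ line (A i)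

theorem mem_linesThrough {n : ℕ} {A : Fin n → DualP2} {P : P2} {i : Fin n} :
    i ∈ linesThrough A P ↔ P ∈ line (A i) := by
  simp [linesThrough]

theorem multiplicity_eq_card {n : ℕ} (A : Fin n → DualP2) (P : P2) :
    multiplicity A P = (linesThrough A P).card := by
  rw [multiplicity, ← Set.ncard_coe_finset]
  congr 1
  ext i
  simp [mem_linesThrough]

/-- The sets of lines through the triple points of an arrangement. -/
noncomputable def tripleBlocks {n : ℕ} (A : Fin n → DualP2) : Finset (Finset (Fin n)) :=
  (Set.toFinite (linesThrough A '' {P | IsTriplePoint A P})).toFinset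

theorem mem_tripleBlocks {n : ℕ} {A : Fin n → DualP2} {s : Finset (Fin n)} :
    s ∈ tripleBlocks A ↔ ∃ P, IsTriplePoint A P ∧ linesThrough A P = s := by
  simp [tripleBlocks]

theorem eq_of_mem_linesThrough {n : ℕ} {A : Fin n → DualP2} (hA : Function.Injective A) {P Q : P2}
    {i j : Fin n} (hij : i ≠ j) (hiP : i ∈ linesThrough A P) (hjP : j ∈ linesThrough A P)
    (hiQ : i ∈ linesThrough A Q) (hjQ : j ∈ linesThrough A Q) : P = Q := by
  classical
  rw [mem_linesThrough] at hiP hjP hiQ hjQ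
  rw [eq_cross (hA.ne hij) hiP hjP, eq_cross (hA.ne hij) hiQ hjQ]

theorem injOn_linesThrough {n : ℕ} {A : Fin n → DualP2} (hA : Function.Injective A) :
    Set.InjOn (linesThrough A) {P | IsTriplePoint A P} := by
  intro P hP Q _ hPQ
  have h1 : 1 < (linesThrough A P).card := by
    rw [← multiplicity_eq_card, show multiplicity A P = 3 from hP]; norm_num
  obtain ⟨i, hi, j, hj, hij⟩ := Finset.one_lt_card.1 h1
  exact eq_of_mem_linesThrough hA hij hi hj (hPQ ▸ hi) (hPQ ▸ hj)

theorem card_tripleBlocks {n : ℕ} {A : Fin n → DualP2} (hA : Function.Injective A) :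
    (tripleBlocks A).card = {P | IsTriplePoint A P}.ncard := by
  rw [← (injOn_linesThrough hA).ncard_image, ← Set.ncard_coe_finset]
  simp [tripleBlocks]

theorem card_filter_tripleBlocks {n : ℕ} {A : Fin n → DualP2} (hA : Function.Injective A)
    (i : Fin n) : ((tripleBlocks A).filter (i ∈ ·)).card =
      {P | P ∈ line (A i) ∧ IsTriplePoint A P}.ncard := by
  rw [← ((injOn_linesThrough hA).mono fun P hP => hP.2).ncard_image,
    ← Set.ncard_coe_finset]
  congr 1
  ext s
  simp only [Finset.coe_filter, mem_tripleBlocks, Set.mem_ofPred_eq, Set.mem_image]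
  constructor
  · rintro ⟨⟨P, hP, rfl⟩, hi⟩
    exact ⟨P, ⟨mem_linesThrough.1 hi, hP⟩, rfl⟩
  · rintro ⟨P, ⟨hi, hP⟩, rfl⟩
    exact ⟨⟨P, hP, rfl⟩, mem_linesThrough.2 hi⟩

theorem isNineThree_tripleBlocks {A : Fin 9 → DualP2} (hA : Function.Injective A)
    (hthree : ∀ i, {P | P ∈ line (A i) ∧ IsTriplePoint A P}.ncard = 3) :
    IsNineThree (tripleBlocks A) where
  card_block s hs := by
    obtain ⟨P, hP, rfl⟩ := mem_tripleBlocks.1 hs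
    rw [← multiplicity_eq_card]
    exact hP
  card_through i := by rw [card_filter_tripleBlocks hA, hthree]
  eq_of_mem s hs t ht i j hij his hjs hit hjt := by
    obtain ⟨P, -, rfl⟩ := mem_tripleBlocks.1 hs
    obtain ⟨Q, -, rfl⟩ := mem_tripleBlocks.1 ht
    rw [eq_of_mem_linesThrough hA hij his hjs hit hjt]

theorem isEssential_of_isMultiplePoint {n : ℕ} {A : Fin n → DualP2} (hA : Function.Injective A)
    (hn : 3 < n) (hmult : ∀ P, IsMultiplePoint A P → IsTriplePoint A P) : IsEssential A := by
  classical
  intro i j hij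
  by_contra! hcon
  simp only [lineDet_eq_zero_iff (hA.ne hij), ← mem_linesThrough] at hcon
  have huniv : multiplicity A (Projectivization.cross (A i) (A j)) = n := by
    rw [multiplicity_eq_card, Finset.eq_univ_iff_forall.2 hcon, Finset.card_univ, Fintype.card_fin]
  have h3 := hmult _ (show 3 ≤ multiplicity A (Projectivization.cross (A i) (A j)) by omega)
  rw [IsTriplePoint] at h3
  omega

/-- Three lines of an arrangement whose multiple points are triple points are dependent exactly if
they are the lines through a triple point. -/
theorem lineDet_eq_zero_iff_mem_tripleBlocks {n : ℕ} {A : Fin n → DualP2}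
    (hA : Function.Injective A) (hmult : ∀ P, IsMultiplePoint A P → IsTriplePoint A P)
    {i j k : Fin n} (hij : i ≠ j) (hik : i ≠ k) (hjk : j ≠ k) :
    lineDet (A i) (A j) (A k) = 0 ↔ {i, j, k} ∈ tripleBlocks A := by
  classical
  rw [lineDet_eq_zero_iff (hA.ne hij), mem_tripleBlocks]
  have hcard : ({i, j, k} : Finset (Fin n)).card = 3 := Finset.card_eq_three.2
    ⟨i, j, k, hij, hik, hjk, rfl⟩
  constructor
  · intro h
    set P := Projectivization.cross (A i) (A j)
    have hsub : {i, j, k} ⊆ linesThrough A P := by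
      intro x hx
      simp only [Finset.mem_insert, Finset.mem_singleton] at hx
      rw [mem_linesThrough]
      rcases hx with rfl | rfl | rfl
      exacts [cross_mem_left (hA.ne hij), cross_mem_right (hA.ne hij), h]
    have htriple : IsTriplePoint A P := hmult P <| by
      rw [IsMultiplePoint, multiplicity_eq_card, ← hcard]
      exact Finset.card_le_card hsub
    refine ⟨P, htriple, (Finset.eq_of_subset_of_card_le hsub ?_).symm⟩
    rw [hcard, ← multiplicity_eq_card]
    exact htriple.le
  · rintro ⟨P, -, hP⟩
    have hmem : ∀ x ∈ ({i, j, k} : Finset (Fin n)), P ∈ line (A x) := fun x hx =>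
      mem_linesThrough.1 (hP ▸ hx)
    rw [← eq_cross (hA.ne hij) (hmem i (by simp)) (hmem j (by simp))]
    exact hmem k (by simp)

theorem tripleDet_eq_zero_of_eq {R : Type*} [CommRing R] {n : ℕ} (v : Fin n → Fin 3 → R)
    {i j k : Fin n} (h : i = j ∨ i = k ∨ j = k) : tripleDet (v i) (v j) (v k) = 0 := by
  rw [tripleDet_expand]
  rcases h with rfl | rfl | rfl <;> ring

theorem tripleDet_eq_zero_of_insert_eq {R : Type*} [CommRing R] {n : ℕ} (v : Fin n → Fin 3 → R)
    {i j k a b c : Fin n} (hs : ({i, j, k} : Finset (Fin n)) = {a, b, c})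
    (h : tripleDet (v a) (v b) (v c) = 0) : tripleDet (v i) (v j) (v k) = 0 := by
  have hi : i ∈ ({a, b, c} : Finset (Fin n)) := hs ▸ by simp
  have hj : j ∈ ({a, b, c} : Finset (Fin n)) := hs ▸ by simp
  have hk : k ∈ ({a, b, c} : Finset (Fin n)) := hs ▸ by simp
  simp only [Finset.mem_insert, Finset.mem_singleton] at hi hj hk
  rw [tripleDet_expand] at h ⊢
  rcases hi with rfl | rfl | rfl <;> rcases hj with rfl | rfl | rfl <;>
    rcases hk with rfl | rfl | rfl <;>
    first
    | ring1
    | linear_combination h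
    | linear_combination -h

/-- A configuration `(9₃)` with nine blocks consists of the blocks of the model that is mapped into
it. -/
theorem exists_blockSet_of_mem {blocks : List (Fin 9 × Fin 9 × Fin 9)}
    (hblocks : blocks ∈ [pappusBlocks, hexagonBlocks, cyclicBlocks])
    {𝓑 : Finset (Finset (Fin 9))} (hcard : 𝓑.card = 9) {σ : Equiv.Perm (Fin 9)}
    (hσ : ∀ b ∈ blocks, (blockSet b).map σ.toEmbedding ∈ 𝓑) {s : Finset (Fin 9)} (hs : s ∈ 𝓑) :
    ∃ b ∈ blocks, (blockSet b).map σ.toEmbedding = s := by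
  let 𝓒 : Finset (Finset (Fin 9)) :=
    (blocks.map blockSet).toFinset.map (Finset.mapEmbedding σ.toEmbedding).toEmbedding
  have h9 : ∀ blocks ∈ [pappusBlocks, hexagonBlocks, cyclicBlocks],
      (blocks.map blockSet).toFinset.card = 9 := by decide +kernel
  have hsub : 𝓒 ⊆ 𝓑 := by
    intro t ht
    simp only [𝓒, Finset.mem_map, List.mem_toFinset, List.mem_map] at ht
    obtain ⟨-, ⟨b, hb, rfl⟩, rfl⟩ := ht
    exact hσ b hb
  have heq : 𝓒 = 𝓑 := Finset.eq_of_subset_of_card_le hsub (by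
    rw [hcard, Finset.card_map, h9 blocks hblocks])
  rw [← heq] at hs
  simp only [𝓒, Finset.mem_map, List.mem_toFinset, List.mem_map] at hs
  obtain ⟨-, ⟨b, hb, rfl⟩, rfl⟩ := hs
  exact ⟨b, hb, rfl⟩

theorem blockSet_map (b : Fin 9 × Fin 9 × Fin 9) (σ : Equiv.Perm (Fin 9)) :
    (blockSet b).map σ.toEmbedding = {σ b.1, σ b.2.1, σ b.2.2} := by
  simp [blockSet]

theorem irreducibleSpace_moduliSpace {A : Fin 9 → DualP2} (hdistinct : Function.Injective A)
    (hnine : {P | IsTriplePoint A P}.ncard = 9)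
    (hmult : ∀ P, IsMultiplePoint A P → IsTriplePoint A P)
    (hthree : ∀ i, {P | P ∈ line (A i) ∧ IsTriplePoint A P}.ncard = 3) :
    IrreducibleSpace (ModuliSpace A) := by
  have hess := isEssential_of_isMultiplePoint hdistinct (by norm_num) hmult
  have hcard : (tripleBlocks A).card = 9 := by rw [card_tripleBlocks hdistinct, hnine]
  obtain ⟨blocks, hblocks, σ, hσ⟩ := (isNineThree_tripleBlocks hdistinct hthree).exists_perm
  obtain ⟨n, v, hdep, hpar⟩ := hasParametrization_of_mem hblocks
  have hne : ∀ blocks ∈ [pappusBlocks, hexagonBlocks, cyclicBlocks], ∀ b ∈ blocks,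
      b.1 ≠ b.2.1 ∧ b.1 ≠ b.2.2 ∧ b.2.1 ≠ b.2.2 := by decide +kernel
  refine irreducibleSpace_of_parametrization (by norm_num) hess (fun i => v (σ.symm i)) ?_ ?_
  · intro i j k h
    by_cases hijk : i = j ∨ i = k ∨ j = k
    · exact tripleDet_eq_zero_of_eq (fun i => v (σ.symm i)) hijk
    push Not at hijk
    obtain ⟨hij, hik, hjk⟩ := hijk
    rw [lineDet_eq_zero_iff_mem_tripleBlocks hdistinct hmult hij hik hjk] at h
    obtain ⟨b, hb, hbs⟩ := exists_blockSet_of_mem hblocks hcard hσ h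
    rw [blockSet_map] at hbs
    refine tripleDet_eq_zero_of_insert_eq (fun i => v (σ.symm i)) hbs.symm ?_
    simpa using hdep b hb
  · intro B hB
    have hreal : Realizes blocks fun i => (B (σ i)).rep := by
      refine ⟨fun b hb => ?_, fun b h12 h13 h23 hfree h0 => ?_⟩
      · obtain ⟨h12, h13, h23⟩ := hne blocks hblocks b hb
        refine (hB _ _ _).2 ?_
        rw [lineDet_eq_zero_iff_mem_tripleBlocks hdistinct hmult (σ.injective.ne h12)
          (σ.injective.ne h13) (σ.injective.ne h23), ← blockSet_map]
        exact hσ b hb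
      · have h1 := (hB _ _ _).1 h0
        rw [lineDet_eq_zero_iff_mem_tripleBlocks hdistinct hmult (σ.injective.ne h12)
          (σ.injective.ne h13) (σ.injective.ne h23), ← blockSet_map] at h1
        obtain ⟨b', hb', hbs⟩ := exists_blockSet_of_mem hblocks hcard hσ h1
        exact hfree b' hb' (Finset.map_injective _ hbs).symm
    obtain ⟨t, N, hN⟩ := hpar _ hreal
    refine ⟨t, N, fun i => ?_⟩
    simpa using hN (σ.symm i)

end LineArrangement

theorem mainTheorem6 (A : Fin 9 → LineArrangement.DualP2)
    (hdistinct : Function.Injective A)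
    (hnine : {P | LineArrangement.IsTriplePoint A P}.ncard = 9)
    (hmult : ∀ P, LineArrangement.IsMultiplePoint A P → LineArrangement.IsTriplePoint A P)
    (hthree : ∀ i, {P | P ∈ LineArrangement.line (A i) ∧
      LineArrangement.IsTriplePoint A P}.ncard = 3) :
    IrreducibleSpace (LineArrangement.ModuliSpace A) :=
  LineArrangement.irreducibleSpace_moduliSpace hdistinct hnine hmult hthree
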